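/- Let $\mathbb{F}_q$ be a finite field, let $n\ge 0$, and let $\gamma\in \mathrm{Sp}_{2n}(\mathbb{F}_q)$ be a semisimple element. For a polynomial $R$ with $R(0)\ne 0$ put $R^*(x)=R(0)^{-1}x^{\deg R}R(x^{-1})$. The characteristic polynomial of $\gamma$ can be written in the form $$(x-1)^{2a_+}(x+1)^{2a_-}\prod_{i=1}^r P_i(x)^{b_i}\prod_{j=1}^s \bigl(Q_j(x)Q_j^*(x)\bigr)^{c_j},\qquad (\ast)$$ where $a_\pm\ge 0$ and $b_i,c_j>0$ are integers (with $a_-=0$ if $q$ is even), $x\pm1$, the $P_i$, the $Q_j$ and the $Q_j^*$ are pairwise distinct monic irreducible polynomials over $\mathbb{F}_q$ (except that $x-1=x+1$ if $q$ is even), $P_i=P_i^*$ for all $i$, and $Q_j\neq Q_j^*$ for all $j$. For every such factorization, each $\deg P_i=2d_i$ is even with $d_i>0$, and with $e_j=\deg Q_j>0$ the scheme-theoretic centralizer $G_\gamma$ of $\gamma$ in the algebraic group $\mathrm{Sp}_{2n}$ over $\mathbb{F}_q$ is isomorphic, as a group scheme over $\mathbb{F}_q$, to $$\mathrm{Sp}_{2a_+}\times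 \mathrm{Sp}_{2a_-}\times\prod_{i=1}^r\mathrm{Res}_{\mathbb{F}_{q^{d_i}}/\mathbb{F}_q}\mathrm{U}_{b_i}\times \prod_{j=1}^s\mathrm{Res}_{\mathbb{F}_{q^{e_j}}/\mathbb{F}_q}\mathrm{GL}_{c_j},$$ where $\mathrm{Res}$ is Weil restriction of scalars and $\mathrm{U}_{b_i}$ is the unitary group of rank $b_i$ over $\mathbb{F}_{q^{d_i}}$ with respect to the quadratic extension $\mathbb{F}_{q^{2d_i}}/\mathbb{F}_{q^{d_i}}$, for the standard Hermitian form. -/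

import Mathlib

open CategoryTheory Polynomial TensorProduct

universe u

namespace AlgGrp

/-- A group functor over `k`: a functor from commutative `k`-algebras to groups. Affine group
schemes over `k` are identified with their functors of points; by Yoneda's lemma, isomorphisms of
affine group schemes over `k` are the natural isomorphisms of these group functors. -/
abbrev GroupFunctor (k : Type u) [CommRing k] := CommAlgCat.{u} k ⥤ GrpCat.{u}

section maps

/-- The homomorphism `Sp₂ₙ(R) → Sp₂ₙ(S)` induced by a ring homomorphism `R → S`. -/
def spMap (n : ℕ) {R S : Type u} [CommRing R] [CommRing S] (f : R →+* S) :
    Matrix.symplecticGroup (Fin n) R →* Matrix.symplecticGroup (Fin n) S where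
  toFun g := ⟨g.1.map f, SymplecticGroup.map_mem g.2 f⟩
  map_one' := Subtype.ext (Matrix.map_one f (map_zero f) (map_one f))
  map_mul' g h := Subtype.ext (Matrix.map_mul (L := g.1) (M := h.1) (f := f))

/-- The base change `id ⊗ f : L ⊗[K] S → L ⊗[K] T` of `f : S → T`. -/
noncomputable def tensorMap {K : Type u} [CommRing K] (L : Type u) [CommRing L] [Algebra K L]
    {S T : Type u} [CommRing S] [Algebra K S] [CommRing T] [Algebra K T] (f : S →ₐ[K] T) :
    L ⊗[K] S →ₐ[L] L ⊗[K] T :=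
  Algebra.TensorProduct.map (AlgHom.id L L) f

/-- The conjugation `σ ⊗ id` of `L ⊗[K] S`. -/
noncomputable def tensorConj {K L : Type u} [CommRing K] [CommRing L] [Algebra K L]
    (σ : L ≃ₐ[K] L) (S : Type u) [CommRing S] [Algebra K S] : L ⊗[K] S →ₐ[K] L ⊗[K] S :=
  Algebra.TensorProduct.map (σ : L →ₐ[K] L) (AlgHom.id K S)

theorem tensorMap_tensorConj {K L : Type u} [CommRing K] [CommRing L] [Algebra K L]
    (σ : L ≃ₐ[K] L) {S T : Type u} [CommRing S] [Algebra K S] [CommRing T] [Algebra K T]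
    (f : S →ₐ[K] T) (x : L ⊗[K] S) :
    tensorConj σ T (tensorMap L f x) = tensorMap L f (tensorConj σ S x) := by
  induction x with
  | zero => simp
  | tmul a b => simp [tensorConj, tensorMap]
  | add x y hx hy => simp only [map_add, hx, hy]

end maps

/-- The symplectic group `Sp₂ₙ` over `k`. -/
def Sp (k : Type u) [CommRing k] (n : ℕ) : GroupFunctor k where
  obj R := GrpCat.of (Matrix.symplecticGroup (Fin n) R)
  map f := GrpCat.ofHom (spMap n (f.hom : _ →+* _))

/-- The general linear group `GL_c` over `k`. -/
def GLn (k : Type u) [CommRing k] (c : ℕ) : GroupFunctor k where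
  obj R := GrpCat.of (Matrix.GeneralLinearGroup (Fin c) R)
  map f := GrpCat.ofHom (Matrix.GeneralLinearGroup.map (f.hom : _ →+* _))

/-- The `S`-points of the unitary group of rank `b` for an extension `L` of `K` with involution
`σ`: the matrices `g ∈ GL_b(L ⊗[K] S)` with `σ(g)ᵀ g = 1`. -/
def unitaryPoints {K L : Type u} [CommRing K] [CommRing L] [Algebra K L] (σ : L ≃ₐ[K] L) (b : ℕ)
    (S : Type u) [CommRing S] [Algebra K S] :
    Subgroup (Matrix.GeneralLinearGroup (Fin b) (L ⊗[K] S)) where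
  carrier := {g | (g.val.map (tensorConj σ S)).transpose *
    g.val = 1}
  one_mem' := by simp
  mul_mem' {g h} hg hh := by
    simp only [Set.mem_ofPred_eq, Units.val_mul, Matrix.map_mul, Matrix.transpose_mul] at *
    rw [Matrix.mul_assoc, ← Matrix.mul_assoc _ g.val, hg, Matrix.one_mul, hh]
  inv_mem' {g} hg := by
    simp only [Set.mem_ofPred_eq] at *
    have h1 : (g⁻¹).val =
        (g.val.map (tensorConj σ S)).transpose := by
      rw [← Matrix.mul_one (Matrix.transpose _), ← Units.mul_inv g, ← Matrix.mul_assoc, hg,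
        Matrix.one_mul]
    nth_rewrite 2 [h1]
    rw [← Matrix.transpose_mul, ← Matrix.map_mul, Units.mul_inv]
    simp

/-- The homomorphism on points of the unitary group induced by `S → T`. -/
noncomputable def unitaryMap {K L : Type u} [CommRing K] [CommRing L] [Algebra K L] (σ : L ≃ₐ[K] L) (b : ℕ)
    {S T : Type u} [CommRing S] [Algebra K S] [CommRing T] [Algebra K T] (f : S →ₐ[K] T) :
    unitaryPoints σ b S →* unitaryPoints σ b T :=
  ((Matrix.GeneralLinearGroup.map (tensorMap L f : L ⊗[K] S →+* L ⊗[K] T)).comp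
    (unitaryPoints σ b S).subtype).codRestrict _ fun g => by
      have hg : (g.1.val.map (tensorConj σ S)).transpose *
        g.1.val = 1 := g.2
      have h2 := congrArg (fun M => M.map (tensorMap L f : L ⊗[K] S →+* L ⊗[K] T)) hg
      change (((g.1.val.map (tensorMap L f)).map
        (tensorConj σ T)).transpose * g.1.val.map (tensorMap L f)) = 1
      simp only [Matrix.map_mul, Matrix.map_map, Matrix.transpose_map] at h2 ⊢
      have h3 : (tensorConj σ T : _ → _) ∘ (tensorMap L f : L ⊗[K] S → L ⊗[K] T) =
          (tensorMap L f : L ⊗[K] S → L ⊗[K] T) ∘ (tensorConj σ S : _ → _) :=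
        funext fun x => tensorMap_tensorConj σ f x
      rw [h3]
      simpa [Matrix.transpose_map] using h2

/-- The unitary group `U_b` over `K` with respect to an extension `L` of `K` with involution
`σ`, for the standard Hermitian form `∑ᵢ σ(xᵢ) yᵢ`. -/
noncomputable def U {K L : Type u} [CommRing K] [CommRing L] [Algebra K L] (σ : L ≃ₐ[K] L) (b : ℕ) :
    GroupFunctor K where
  obj S := GrpCat.of (unitaryPoints σ b S)
  map f := GrpCat.ofHom (unitaryMap σ b f.hom)
  map_id S := by
    ext g i j
    change tensorMap L (AlgHom.id K S) (g.1.val i j) = _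
    simp [tensorMap]
  map_comp {S T V} f f' := by
    ext g i j
    change tensorMap L (f'.hom.comp f.hom) (g.1.val i j) =
      tensorMap L f'.hom (tensorMap L f.hom (g.1.val i j))
    generalize g.1.val i j = x
    induction x with
    | zero => simp
    | tmul a b => simp [tensorMap]
    | add x y hx hy => simp only [map_add, hx, hy]

/-- Weil restriction of scalars: `(Res_{K/k} G)(R) = G(K ⊗[k] R)`. -/
noncomputable def Res (k : Type u) {K : Type u} [CommRing k] [CommRing K] [Algebra k K]
    (G : GroupFunctor K) : GroupFunctor k where
  obj R := G.obj (CommAlgCat.of K (K ⊗[k] R))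
  map f := G.map (CommAlgCat.ofHom (tensorMap K f.hom))
  map_id R := by
    rw [← G.map_id]
    congr 1
    ext
    simp [tensorMap]
  map_comp f g := by
    rw [← G.map_comp]
    congr 1
    ext
    simp [tensorMap]

/-- The product of two group functors. -/
def prod {k : Type u} [CommRing k] (G H : GroupFunctor k) : GroupFunctor k where
  obj R := GrpCat.of (G.obj R × H.obj R)
  map f := GrpCat.ofHom (MonoidHom.prodMap (G.map f).hom (H.map f).hom)

/-- The product of a family of group functors indexed by `Fin m`. -/
def pi {k : Type u} [CommRing k] {m : ℕ} (G : Fin m → GroupFunctor k) : GroupFunctor k where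
  obj R := GrpCat.of (∀ i, (G i).obj R)
  map f := GrpCat.ofHom (MonoidHom.piMap fun i => ((G i).map f).hom)

/-- The scheme-theoretic centralizer `G_γ` of a `k`-point `γ` of `G = Sp₂ₙ`: its `R`-points are
the elements of `Sp₂ₙ(R)` commuting with the image of `γ`. -/
def spCentralizer {k : Type u} [CommRing k] {n : ℕ} (γ : Matrix.symplecticGroup (Fin n) k) :
    GroupFunctor k where
  obj R := GrpCat.of (Subgroup.centralizer {spMap n (algebraMap k R) γ})
  map {R S} f := GrpCat.ofHom <|
    ((spMap n (f.hom : R →+* S)).comp (Subgroup.subtype _)).codRestrict _ fun g => by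
      have h : spMap n (f.hom : R →+* S) (spMap n (algebraMap k R) γ) =
          spMap n (algebraMap k S) γ := by
        refine Subtype.ext (Matrix.ext fun i j => ?_)
        exact f.hom.commutes _
      rw [Subgroup.mem_centralizer_singleton_iff, ← h]
      simp only [MonoidHom.comp_apply, ← map_mul]
      exact congrArg _ (Subgroup.mem_centralizer_singleton_iff.1 g.2)

end AlgGrp

/-- The reciprocal polynomial `R(0)⁻¹ x^{deg R} R(x⁻¹)` (for `R(0) ≠ 0`). -/
noncomputable def Polynomial.reciprocalPoly {F : Type u} [Field F] (R : F[X]) : F[X] :=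
  C (R.coeff 0)⁻¹ * R.reverse

/-- A factorization of `f` of the form
`(x-1)^{2a₊} (x+1)^{2a₋} ∏ᵢ Pᵢ^{bᵢ} ∏ⱼ (Qⱼ Qⱼ*)^{cⱼ}`, where the polynomials `x ± 1`, `Pᵢ`, `Qⱼ`,
`Qⱼ*` are distinct, irreducible and monic, the `Pᵢ` are self-reciprocal and the `Qⱼ` are not.
In characteristic two, where `x - 1 = x + 1`, one takes `a₋ = 0`. -/
structure SymplecticFactorization {F : Type u} [Field F] (f : F[X]) where
  aPlus : ℕ
  aMinus : ℕ
  r : ℕ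
  s : ℕ
  P : Fin r → F[X]
  b : Fin r → ℕ
  Q : Fin s → F[X]
  c : Fin s → ℕ
  aMinus_eq_zero : ringChar F = 2 → aMinus = 0
  P_monic : ∀ i, (P i).Monic
  P_irreducible : ∀ i, Irreducible (P i)
  P_reciprocal : ∀ i, (P i).reciprocalPoly = P i
  P_ne : ∀ i, P i ≠ X - 1 ∧ P i ≠ X + 1
  P_injective : Function.Injective P
  b_pos : ∀ i, 0 < b i
  Q_monic : ∀ j, (Q j).Monic
  Q_irreducible : ∀ j, Irreducible (Q j)
  Q_coeff_zero : ∀ j, (Q j).coeff 0 ≠ 0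
  Q_reciprocal_ne : ∀ j j', (Q j).reciprocalPoly ≠ Q j'
  Q_injective : Function.Injective Q
  c_pos : ∀ j, 0 < c j
  eq_prod : f = (X - 1) ^ (2 * aPlus) * (X + 1) ^ (2 * aMinus) * (∏ i, P i ^ b i) *
    ∏ j, (Q j * (Q j).reciprocalPoly) ^ c j

/-! Let V be the standard symplectic space over F, with form B, and let adj be the adjoint
involution of End(V). A matrix g is symplectic exactly when adj(g) g = 1; in particular adj(γ) =
γ⁻¹, so adj preserves the centralizer algebra C of γ. Since C is the kernel of an F-linear map and
every F-algebra is flat, forming C commutes with base change. Hence the centralizer of γ is the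
functor R ↦ {g ∈ (R ⊗ C)ˣ : adj(g) g = 1} (`spCentralizer_iso`), and only the algebra with
involution (C, adj) has to be determined.

Semisimplicity makes the minimal polynomial squarefree, so V is the direct sum of the kernels of
f(γ) for the irreducible factors f. The projections e_f are polynomials in γ, hence central in C,
and adj(γ) = γ⁻¹ gives adj(e_f) = e_{f*} (`IsProj.adj`). So (C, adj) is a product of blocks of three
kinds.

For f = x ∓ 1, γ is the scalar ±1 on the block, which is a full matrix algebra with the adjoint of a
nondegenerate alternating form; a symplectic basis yields Sp (`hasModel_sympAnti`).

For any other f = f*, the block is a vector space over L = F[α], with f(α) = 0, on which γ acts as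
α, and α ↦ α⁻¹ is the involution σ of L. The form B is the trace of a skew-Hermitian form, which a
scalar turns into a Hermitian one. Norms of finite fields are surjective, so there is an orthonormal
basis, and the adjoint becomes the conjugate transpose: this yields U (`hasModel_conjAnti`).

For a pair f ≠ f*, adj exchanges two matrix algebras; the second component of an isometry is
determined by the first, which is an arbitrary invertible matrix. This yields GL
(`hasModel_swapAnti`).

A factorization exists because the characteristic polynomial is palindromic and the eigenspaces for
±1 carry nondegenerate alternating forms, so are even-dimensional (`even_multiplicity`). The degree
of P_i is even because inversion has order 2 in a Galois group of order deg P_i. -/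

namespace AlgGrp

/-! ### Isomorphisms of group functors -/

section general

variable {k : Type u} [CommRing k]

/-- A natural family of bijective homomorphisms is an isomorphism of group functors. -/
theorem nonempty_iso_of_bijective {G H : GroupFunctor k} (φ : ∀ R, G.obj R →* H.obj R)
    (nat : ∀ {R S : CommAlgCat.{u} k} (f : R ⟶ S) (g : G.obj R),
      φ S ((G.map f).hom g) = (H.map f).hom (φ R g))
    (bij : ∀ R, Function.Bijective (φ R)) : Nonempty (G ≅ H) :=
  ⟨NatIso.ofComponents (fun R => (MulEquiv.ofBijective (φ R) (bij R)).toGrpIso) fun f => by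
    ext g
    exact nat f g⟩

theorem prod_congr {G G' H H' : GroupFunctor k} (hG : Nonempty (G ≅ G'))
    (hH : Nonempty (H ≅ H')) : Nonempty (prod G H ≅ prod G' H') := by
  obtain ⟨a⟩ := hG
  obtain ⟨b⟩ := hH
  refine nonempty_iso_of_bijective
    (fun R => MonoidHom.prodMap (a.hom.app R).hom (b.hom.app R).hom) ?_ ?_
  · intro R S f g
    exact Prod.ext (ConcreteCategory.congr_hom (a.hom.naturality f) g.1)
      (ConcreteCategory.congr_hom (b.hom.naturality f) g.2)
  · intro R
    exact Function.Bijective.prodMap (ConcreteCategory.bijective_of_isIso (a.hom.app R))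
      (ConcreteCategory.bijective_of_isIso (b.hom.app R))

theorem pi_congr {m : ℕ} {G G' : Fin m → GroupFunctor k} (h : ∀ i, Nonempty (G i ≅ G' i)) :
    Nonempty (pi G ≅ pi G') := by
  let a := fun i => (h i).some
  refine nonempty_iso_of_bijective
    (fun R => MonoidHom.piMap fun i => ((a i).hom.app R).hom) ?_ ?_
  · intro R S f g
    exact funext fun i => ConcreteCategory.congr_hom ((a i).hom.naturality f) (g i)
  · intro R
    exact Function.Bijective.piMap fun i => ConcreteCategory.bijective_of_isIso ((a i).hom.app R)

end general

/-! ### Algebras with an antimultiplicative map -/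

/-- A unital `F`-linear antimultiplicative endomorphism of an algebra. -/
structure AntiHom (F A : Type*) [CommRing F] [Ring A] [Algebra F A] extends A →ₗ[F] A where
  map_one : toFun 1 = 1
  map_mul : ∀ a b : A, toFun (a * b) = toFun b * toFun a

namespace AntiHom

variable {F A B : Type u} [CommRing F] [Ring A] [Algebra F A] [Ring B] [Algebra F B]

/-- The base change of an antimultiplicative map. -/
noncomputable def base (τ : AntiHom F A) (R : Type u) [CommRing R] [Algebra F R] :
    R ⊗[F] A →ₗ[R] R ⊗[F] A :=
  τ.toLinearMap.baseChange R

@[simp]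
theorem base_tmul (τ : AntiHom F A) (R : Type u) [CommRing R] [Algebra F R] (r : R) (a : A) :
    τ.base R (r ⊗ₜ a) = r ⊗ₜ τ.toLinearMap a := rfl

theorem base_one (τ : AntiHom F A) (R : Type u) [CommRing R] [Algebra F R] : τ.base R 1 = 1 := by
  rw [Algebra.TensorProduct.one_def, base_tmul]
  exact congrArg _ τ.map_one

theorem base_mul (τ : AntiHom F A) (R : Type u) [CommRing R] [Algebra F R] (x y : R ⊗[F] A) :
    τ.base R (x * y) = τ.base R y * τ.base R x := by
  induction x with
  | zero => simp
  | add x x' hx hx' => simp only [add_mul, mul_add, map_add, hx, hx']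
  | tmul r a =>
    induction y with
    | zero => simp
    | add x x' hx hx' => simp only [add_mul, mul_add, map_add, hx, hx']
    | tmul s b =>
      simp only [Algebra.TensorProduct.tmul_mul_tmul, base_tmul, mul_comm r s]
      exact congrArg _ (τ.map_mul a b)

theorem base_map (τ : AntiHom F A) (τ' : AntiHom F B) (f : A →ₗ[F] B)
    (hf : ∀ a, f (τ.toLinearMap a) = τ'.toLinearMap (f a))
    {R S : Type u} [CommRing R] [Algebra F R] [CommRing S] [Algebra F S] (g : R →ₗ[F] S)
    (x : R ⊗[F] A) :
    TensorProduct.map g f (τ.base R x) = τ'.base S (TensorProduct.map g f x) := by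
  induction x with
  | zero => simp
  | add x x' hx hx' => simp only [map_add, hx, hx']
  | tmul r a => simp [hf]

/-- The product of two antimultiplicative maps. -/
def prod (τ : AntiHom F A) (τ' : AntiHom F B) : AntiHom F (A × B) where
  toLinearMap := LinearMap.prodMap τ.toLinearMap τ'.toLinearMap
  map_one := Prod.ext τ.map_one τ'.map_one
  map_mul _ _ := Prod.ext (τ.map_mul _ _) (τ'.map_mul _ _)

/-- The product of a family of antimultiplicative maps. -/
def pi {ι : Type} {A : ι → Type u} [∀ i, Ring (A i)] [∀ i, Algebra F (A i)]
    (τ : ∀ i, AntiHom F (A i)) : AntiHom F (∀ i, A i) where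
  toLinearMap := LinearMap.pi fun i => (τ i).toLinearMap ∘ₗ LinearMap.proj i
  map_one := funext fun i => (τ i).map_one
  map_mul _ _ := funext fun i => (τ i).map_mul _ _

end AntiHom

/-! ### Isometry groups of algebras with an antimultiplicative map -/

section unitary

variable {F A B : Type u} [CommRing F] [Ring A] [Algebra F A] [Ring B] [Algebra F B]

/-- The group of `g ∈ (R ⊗ A)ˣ` with `τ(g) g = 1`. -/
def isoPoints (τ : AntiHom F A) (R : Type u) [CommRing R] [Algebra F R] :
    Subgroup (R ⊗[F] A)ˣ where
  carrier := {g | τ.base R g.val * g.val = 1}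
  one_mem' := by simp [τ.base_one]
  mul_mem' {g h} hg hh := by
    simp only [Set.mem_ofPred_eq, Units.val_mul, τ.base_mul] at *
    rw [mul_assoc, ← mul_assoc _ g.val, hg, one_mul, hh]
  inv_mem' {g} hg := by
    simp only [Set.mem_ofPred_eq] at *
    have h1 : (g⁻¹).val = τ.base R g.val := by
      rw [← mul_one (τ.base R g.val), ← Units.mul_inv g, ← mul_assoc, hg, one_mul]
    nth_rewrite 2 [h1]
    rw [← τ.base_mul, Units.mul_inv, τ.base_one]

theorem mem_isoPoints {τ : AntiHom F A} {R : Type u} [CommRing R] [Algebra F R]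
    {g : (R ⊗[F] A)ˣ} : g ∈ isoPoints τ R ↔ τ.base R g.val * g.val = 1 := Iff.rfl

/-- The homomorphism `isoPoints τ R → isoPoints τ' S` induced by `R → S` and `A → B`. -/
noncomputable def isoMap {τ : AntiHom F A} {τ' : AntiHom F B} (f : A →ₐ[F] B)
    (hf : ∀ a, f (τ.toLinearMap a) = τ'.toLinearMap (f a))
    {R S : Type u} [CommRing R] [Algebra F R] [CommRing S] [Algebra F S] (φ : R →ₐ[F] S) :
    isoPoints τ R →* isoPoints τ' S :=
  ((Units.map (Algebra.TensorProduct.map φ f : R ⊗[F] A →* S ⊗[F] B)).comp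
    (isoPoints τ R).subtype).codRestrict _ fun g => by
      have h := congrArg (Algebra.TensorProduct.map φ f) (mem_isoPoints.1 g.2)
      rw [map_mul, map_one] at h
      rw [mem_isoPoints, ← h]
      exact congrArg (· * _) (AntiHom.base_map τ τ' f.toLinearMap hf φ.toLinearMap _).symm

theorem isoPoints_ext {τ : AntiHom F A} {R : Type u} [CommRing R] [Algebra F R]
    {g h : isoPoints τ R} (H : g.1.val = h.1.val) : g = h :=
  Subtype.ext (Units.ext H)

/-- An element `x` with `τ(x) x = 1` and `x τ(x) = 1` as a point of the isometry group. -/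
noncomputable def isoPoints.mk {τ : AntiHom F A} {R : Type u} [CommRing R] [Algebra F R]
    (x : R ⊗[F] A) (h : τ.base R x * x = 1) (h' : x * τ.base R x = 1) : isoPoints τ R :=
  ⟨⟨x, τ.base R x, h', h⟩, h⟩

theorem isoPoints.mul_base {τ : AntiHom F A} {R : Type u} [CommRing R] [Algebra F R]
    (g : isoPoints τ R) : g.1.val * τ.base R g.1.val = 1 := by
  have h1 : (g.1⁻¹).val = τ.base R g.1.val := by
    rw [← mul_one (τ.base R g.1.val), ← Units.mul_inv g.1, ← mul_assoc, mem_isoPoints.1 g.2,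
      one_mul]
  rw [← h1, Units.mul_inv]

/-- The isometry group of an algebra with an antimultiplicative map `τ`: its `R`-points are the
`g ∈ (R ⊗ A)ˣ` with `τ(g) g = 1`. -/
noncomputable def Iso (τ : AntiHom F A) : GroupFunctor F where
  obj R := GrpCat.of (isoPoints τ R)
  map φ := GrpCat.ofHom (isoMap (AlgHom.id F A) (fun _ => rfl) φ.hom)
  map_id R := by
    ext g
    change Algebra.TensorProduct.map (AlgHom.id F R) (AlgHom.id F A) g.1.val = _
    simp
  map_comp {R S T} φ ψ := by
    ext g
    change Algebra.TensorProduct.map (ψ.hom.comp φ.hom) (AlgHom.id F A) g.1.val =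
      Algebra.TensorProduct.map ψ.hom (AlgHom.id F A)
        (Algebra.TensorProduct.map φ.hom (AlgHom.id F A) g.1.val)
    rw [← AlgHom.comp_apply, ← Algebra.TensorProduct.map_comp]
    simp

theorem map_id_map (f : A →ₐ[F] B)
    {R S : Type u} [CommRing R] [Algebra F R] [CommRing S] [Algebra F S] (φ : R →ₐ[F] S)
    (x : R ⊗[F] A) :
    Algebra.TensorProduct.map (AlgHom.id F S) f
      (Algebra.TensorProduct.map φ (AlgHom.id F A) x) =
    Algebra.TensorProduct.map φ (AlgHom.id F B)
      (Algebra.TensorProduct.map (AlgHom.id F R) f x) := by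
  induction x with
  | zero => simp
  | add x y hx hy => simp only [map_add, hx, hy]
  | tmul r a => rfl

theorem isoMap_comm {τ : AntiHom F A} {τ' : AntiHom F B} (f : A →ₐ[F] B)
    (hf : ∀ a, f (τ.toLinearMap a) = τ'.toLinearMap (f a))
    {R S : Type u} [CommRing R] [Algebra F R] [CommRing S] [Algebra F S] (φ : R →ₐ[F] S)
    (g : isoPoints τ R) :
    isoMap f hf (AlgHom.id F S) (isoMap (τ' := τ) (AlgHom.id F A) (fun _ => rfl) φ g) =
      isoMap (τ := τ') (AlgHom.id F B) (fun _ => rfl) φ (isoMap f hf (AlgHom.id F R) g) :=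
  isoPoints_ext (map_id_map f φ g.1.val)

/-- Tensoring with R commutes with finite products of algebras, and the equation τ(g) g = 1 is
checked componentwise. This lets the blocks of the centralizer be treated separately. -/
theorem iso_prod (τ : AntiHom F A) (τ' : AntiHom F B) :
    Nonempty (Iso (τ.prod τ') ≅ prod (Iso τ) (Iso τ')) := by
  refine nonempty_iso_of_bijective
    (fun R => MonoidHom.prod
      (isoMap (τ := τ.prod τ') (τ' := τ) (AlgHom.fst F A B) (fun _ => rfl) (AlgHom.id F R))
      (isoMap (τ := τ.prod τ') (τ' := τ') (AlgHom.snd F A B) (fun _ => rfl) (AlgHom.id F R))) ?_ ?_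
  · intro R S f g
    exact Prod.ext (isoMap_comm _ _ _ _) (isoMap_comm _ _ _ _)
  · intro R
    let e := Algebra.TensorProduct.prodRight F R R A B
    have he1 : ∀ x, (e x).1 = Algebra.TensorProduct.map (AlgHom.id F R) (AlgHom.fst F A B) x := by
      intro x
      induction x with
      | zero => simp
      | add x y hx hy => simp only [map_add, ← hx, ← hy, Prod.fst_add]
      | tmul r a => rfl
    have he2 : ∀ x, (e x).2 = Algebra.TensorProduct.map (AlgHom.id F R) (AlgHom.snd F A B) x := by
      intro x
      induction x with
      | zero => simp
      | add x y hx hy => simp only [map_add, ← hx, ← hy, Prod.snd_add]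
      | tmul r a => rfl
    have heτ : ∀ x, e ((τ.prod τ').base R x) = (τ.base R (e x).1, τ'.base R (e x).2) := by
      intro x
      induction x with
      | zero => simp only [map_zero, Prod.fst_zero, Prod.snd_zero]; rfl
      | add x y hx hy => simp only [map_add, hx, hy, Prod.fst_add, Prod.snd_add, Prod.mk_add_mk]
      | tmul r a => rfl
    constructor
    · intro g h H
      apply isoPoints_ext
      apply e.injective
      refine Prod.ext ?_ ?_
      · rw [he1, he1]
        exact congrArg (fun z => z.1.1.val) H
      · rw [he2, he2]
        exact congrArg (fun z => z.2.1.val) H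
    · rintro ⟨g, h⟩
      refine ⟨isoPoints.mk (e.symm (g.1.val, h.1.val)) ?_ ?_, ?_⟩
      · apply e.injective
        rw [map_mul, heτ, AlgEquiv.apply_symm_apply, map_one]
        exact Prod.ext (mem_isoPoints.1 g.2) (mem_isoPoints.1 h.2)
      · apply e.injective
        rw [map_mul, heτ, AlgEquiv.apply_symm_apply, map_one]
        exact Prod.ext (isoPoints.mul_base g) (isoPoints.mul_base h)
      · refine Prod.ext (isoPoints_ext ?_) (isoPoints_ext ?_)
        · exact (he1 _).symm.trans (congrArg Prod.fst (e.apply_symm_apply _))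
        · exact (he2 _).symm.trans (congrArg Prod.snd (e.apply_symm_apply _))

theorem iso_pi {m : ℕ} {A : Fin m → Type u} [∀ i, Ring (A i)] [∀ i, Algebra F (A i)]
    (τ : ∀ i, AntiHom F (A i)) :
    Nonempty (Iso (AntiHom.pi τ) ≅ pi fun i => Iso (τ i)) := by
  refine nonempty_iso_of_bijective
    (fun R => MonoidHom.pi fun i =>
      (isoMap (τ := AntiHom.pi τ) (τ' := τ i) (Pi.evalAlgHom F A i) (fun _ => rfl)
        (AlgHom.id F R))) ?_ ?_
  · intro R S f g
    exact funext fun i => isoMap_comm (Pi.evalAlgHom F A i) (fun _ => rfl) _ _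
  · intro R
    let e := Algebra.TensorProduct.piRight F R R A
    have he : ∀ x i, e x i =
        Algebra.TensorProduct.map (AlgHom.id F R) (Pi.evalAlgHom F A i) x := by
      intro x i
      induction x with
      | zero => simp
      | add x y hx hy => simp only [map_add, ← hx, ← hy, Pi.add_apply]
      | tmul r a => rfl
    have heτ : ∀ x, e ((AntiHom.pi τ).base R x) = fun i => (τ i).base R (e x i) := by
      intro x
      induction x with
      | zero => ext; simp
      | add x y hx hy => ext i; simp only [map_add, hx, hy, Pi.add_apply]
      | tmul r a => rfl
    constructor
    · intro g h H
      apply isoPoints_ext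
      apply e.injective
      funext i
      rw [he, he]
      exact congrArg (fun z => (z i).1.val) H
    · intro g
      refine ⟨isoPoints.mk (e.symm fun i => (g i).1.val) ?_ ?_, ?_⟩
      · apply e.injective
        rw [map_mul, heτ, AlgEquiv.apply_symm_apply, map_one]
        exact funext fun i => mem_isoPoints.1 (g i).2
      · apply e.injective
        rw [map_mul, heτ, AlgEquiv.apply_symm_apply, map_one]
        exact funext fun i => isoPoints.mul_base (g i)
      · exact funext fun i => isoPoints_ext
          ((he _ i).symm.trans (congrFun (e.apply_symm_apply _) i))

end unitary

end AlgGrp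

namespace AlgGrp

/-! ### The symplectic adjoint and its base change -/

section symplectic

/-- The adjoint `g ↦ J⁻¹ gᵀ J` with respect to the standard symplectic form. -/
def sympAnti (F : Type u) [CommRing F] (l : Type) [Fintype l] [DecidableEq l] :
    AntiHom F (Matrix (l ⊕ l) (l ⊕ l) F) where
  toFun g := -(Matrix.J l F * g.transpose * Matrix.J l F)
  map_add' g h := by
    rw [Matrix.transpose_add, Matrix.mul_add, Matrix.add_mul, neg_add]
  map_smul' c g := by simp
  map_one := by simp [Matrix.J_squared]
  map_mul g h := by
    -- Inserting J² = -1 between the two transposes accounts for the sign in the definition of the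
    -- adjoint.
    have : Matrix.J l F * (h.transpose * g.transpose) * Matrix.J l F =
      -(Matrix.J l F * h.transpose * (Matrix.J l F * Matrix.J l F) * g.transpose *
        Matrix.J l F) := by
      rw [Matrix.J_squared]
      simp [Matrix.mul_assoc]
    simp only [Matrix.transpose_mul, this, neg_neg, Matrix.neg_mul, Matrix.mul_neg]
    simp only [Matrix.mul_assoc]

variable {F : Type u} [CommRing F]

theorem sympAnti_apply {l : Type} [Fintype l] [DecidableEq l] (g : Matrix (l ⊕ l) (l ⊕ l) F) :
    (sympAnti F l).toLinearMap g = -(Matrix.J l F * g.transpose * Matrix.J l F) := rfl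

theorem mem_symplecticGroup_iff_sympAnti {l : Type} [Fintype l] [DecidableEq l]
    {g : Matrix (l ⊕ l) (l ⊕ l) F} :
    g ∈ Matrix.symplecticGroup l F ↔ (sympAnti F l).toLinearMap g * g = 1 := by
  rw [SymplecticGroup.mem_iff', sympAnti_apply]
  constructor
  · intro h
    rw [Matrix.neg_mul, Matrix.mul_assoc, Matrix.mul_assoc, ← Matrix.mul_assoc g.transpose, h,
      Matrix.J_squared, neg_neg]
  · intro h
    have := congrArg (Matrix.J l F * ·) h
    simp only [Matrix.mul_one, Matrix.neg_mul, Matrix.mul_neg, ← Matrix.mul_assoc,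
      Matrix.J_squared, Matrix.one_mul, neg_neg] at this
    exact this

/-- The `R`-algebra homomorphism `R ⊗ D → M_N(R)` induced by `D → M_N(F)`. -/
noncomputable def baseMatrix {N : Type} [Fintype N] [DecidableEq N] {D : Type u} [Ring D]
    [Algebra F D] (Φ : D →ₐ[F] Matrix N N F) (R : Type u) [CommRing R] [Algebra F R] :
    R ⊗[F] D →ₐ[F] Matrix N N R :=
  (matrixEquivTensor N F R).symm.toAlgHom.comp (Algebra.TensorProduct.map (AlgHom.id F R) Φ)

theorem baseMatrix_tmul {N : Type} [Fintype N] [DecidableEq N] {D : Type u} [Ring D]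
    [Algebra F D] (Φ : D →ₐ[F] Matrix N N F) (R : Type u) [CommRing R] [Algebra F R] (r : R)
    (d : D) : baseMatrix Φ R (r ⊗ₜ d) = r • (Φ d).map (algebraMap F R) := rfl

theorem baseMatrix_map {N : Type} [Fintype N] [DecidableEq N] {D : Type u} [Ring D]
    [Algebra F D] (Φ : D →ₐ[F] Matrix N N F) {R S : Type u} [CommRing R] [Algebra F R]
    [CommRing S] [Algebra F S] (φ : R →ₐ[F] S) (x : R ⊗[F] D) :
    baseMatrix Φ S (Algebra.TensorProduct.map φ (AlgHom.id F D) x) =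
      (baseMatrix Φ R x).map φ := by
  induction x with
  | zero => ext; simp
  | add x y hx hy => ext; simp [hx, hy]
  | tmul r d => ext i j; simp [baseMatrix_tmul]

theorem baseMatrix_base {n : ℕ} {D : Type u} [Ring D]
    [Algebra F D] {τ : AntiHom F D} (Φ : D →ₐ[F] Matrix (Fin n ⊕ Fin n) (Fin n ⊕ Fin n) F)
    (hΦ : ∀ d, (sympAnti F (Fin n)).toLinearMap (Φ d) = Φ (τ.toLinearMap d))
    {R : Type u} [CommRing R] [Algebra F R] (x : R ⊗[F] D) :
    baseMatrix Φ R (τ.base R x) = (sympAnti R (Fin n)).toLinearMap (baseMatrix Φ R x) := by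
  induction x with
  | zero => simp
  | add x y hx hy => simp [hx, hy]
  | tmul r d =>
    rw [AntiHom.base_tmul, baseMatrix_tmul, baseMatrix_tmul, map_smul, ← hΦ, sympAnti_apply,
      sympAnti_apply]
    congr 1
    rw [Matrix.map_neg _ (map_neg _), Matrix.map_mul, Matrix.map_mul, Matrix.map_J,
      Matrix.transpose_map]

end symplectic

/-! ### The centralizer as an isometry group -/

section centralizer

variable {F : Type u} [Field F]

theorem baseMatrix_injective {N : Type} [Fintype N] [DecidableEq N] {D : Type u} [Ring D]
    [Algebra F D] {Φ : D →ₐ[F] Matrix N N F} (hΦ : Function.Injective Φ) (R : Type u) [CommRing R]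
    [Algebra F R] : Function.Injective (baseMatrix Φ R) := by
  have h : Function.Injective (Φ.toLinearMap.lTensor R) :=
    Module.Flat.lTensor_preserves_injective_linearMap _ hΦ
  exact (matrixEquivTensor N F R).symm.injective.comp h

/-- The centralizer algebra commutes with base change: it is the kernel of the linear map g ↦ γg -
gγ, and tensoring with R over a field is exact. This is what makes the scheme-theoretic centralizer
accessible from F-points of the algebra. -/
theorem mem_range_baseMatrix {N : Type} [Fintype N] [DecidableEq N] {D : Type u} [Ring D]
    [Algebra F D] {Φ : D →ₐ[F] Matrix N N F} {γ : Matrix N N F}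
    (hΦ : ∀ g, g ∈ Set.range Φ ↔ Commute γ g) {R : Type u} [CommRing R]
    [Algebra F R] {g : Matrix N N R} :
    g ∈ Set.range (baseMatrix Φ R) ↔ Commute (γ.map (algebraMap F R)) g := by
  let c : Matrix N N F →ₗ[F] Matrix N N F := LinearMap.mulLeft F γ - LinearMap.mulRight F γ
  have hex : Function.Exact Φ.toLinearMap c := by
    intro x
    change γ * x - x * γ = 0 ↔ x ∈ Set.range Φ
    rw [hΦ, sub_eq_zero]
    rfl
  have hex' := Module.Flat.lTensor_exact R hex
  have hc : ∀ x : R ⊗[F] Matrix N N F, (matrixEquivTensor N F R).symm (c.lTensor R x) =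
      γ.map (algebraMap F R) * (matrixEquivTensor N F R).symm x -
        (matrixEquivTensor N F R).symm x * γ.map (algebraMap F R) := by
    intro x
    induction x with
    | zero => simp
    | add x y hx hy =>
      simp only [map_add, hx, hy, Matrix.mul_add, Matrix.add_mul]
      abel
    | tmul r d =>
      rw [LinearMap.lTensor_tmul, matrixEquivTensor_apply_symm, matrixEquivTensor_apply_symm]
      change r • (γ * d - d * γ).map _ = _
      rw [Matrix.map_sub _ (map_sub _), Matrix.map_mul, Matrix.map_mul, smul_sub,
        Matrix.mul_smul, Matrix.smul_mul]
  obtain ⟨x, rfl⟩ := (matrixEquivTensor N F R).symm.surjective g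
  have h1 := hex' x
  rw [← (matrixEquivTensor N F R).symm.injective.eq_iff, hc, map_zero, sub_eq_zero] at h1
  refine Iff.trans ?_ h1.symm
  constructor
  · rintro ⟨y, hy⟩
    exact ⟨y, (matrixEquivTensor N F R).symm.injective hy⟩
  · rintro ⟨y, hy⟩
    exact ⟨y, congrArg (matrixEquivTensor N F R).symm hy⟩

/-- If an algebra `D` with an antimultiplicative map is identified with the centralizer algebra of
`γ` in `M₂ₙ(F)`, then the centralizer of `γ` in `Sp₂ₙ` is the isometry group of `D`. -/
theorem spCentralizer_iso {n : ℕ} (γ : Matrix.symplecticGroup (Fin n) F) {D : Type u} [Ring D]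
    [Algebra F D] {τ : AntiHom F D} (Φ : D →ₐ[F] Matrix (Fin n ⊕ Fin n) (Fin n ⊕ Fin n) F)
    (inj : Function.Injective Φ) (range : ∀ g, g ∈ Set.range Φ ↔ Commute γ.1 g)
    (hΦ : ∀ d, (sympAnti F (Fin n)).toLinearMap (Φ d) = Φ (τ.toLinearMap d)) :
    Nonempty (Iso τ ≅ spCentralizer γ) := by
  have mem : ∀ (R : Type u) [CommRing R] [Algebra F R] (g : isoPoints τ R),
      baseMatrix Φ R g.1.val ∈ Matrix.symplecticGroup (Fin n) R := by
    intro R _ _ g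
    rw [mem_symplecticGroup_iff_sympAnti, ← baseMatrix_base Φ hΦ, ← map_mul,
      mem_isoPoints.1 g.2, map_one]
  let φ (R : Type u) [CommRing R] [Algebra F R] :
      isoPoints τ R →* Matrix.symplecticGroup (Fin n) R :=
    { toFun g := ⟨baseMatrix Φ R g.1.val, mem R g⟩
      map_one' := Subtype.ext (map_one (baseMatrix Φ R))
      map_mul' g h := Subtype.ext (map_mul (baseMatrix Φ R) _ _) }
  have mem' : ∀ (R : Type u) [CommRing R] [Algebra F R] (g : isoPoints τ R),
      φ R g ∈ Subgroup.centralizer {spMap n (algebraMap F R) γ} := by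
    intro R _ _ g
    rw [Subgroup.mem_centralizer_singleton_iff]
    exact Subtype.ext ((mem_range_baseMatrix range).1 ⟨g.1.val, rfl⟩).eq.symm
  refine nonempty_iso_of_bijective (fun R => (φ R).codRestrict _ (mem' R)) ?_ ?_
  · intro R S f g
    exact Subtype.ext (Subtype.ext (baseMatrix_map Φ f.hom _))
  · intro R
    constructor
    · intro g h H
      exact isoPoints_ext (baseMatrix_injective inj R (congrArg (fun z => z.1.1) H))
    · intro g
      have hg : Commute (γ.1.map (algebraMap F R)) g.1.1 :=
        (congrArg Subtype.val (Subgroup.mem_centralizer_singleton_iff.1 g.2)).symm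
      obtain ⟨x, hx⟩ := (mem_range_baseMatrix range).2 hg
      have h1 := mem_symplecticGroup_iff_sympAnti.1 g.1.2
      rw [← hx, ← baseMatrix_base Φ hΦ] at h1
      -- Square matrices over a commutative ring have two-sided inverses as soon as they have
      -- one-sided ones; this must be used before pulling back to R ⊗ D.
      have h2 := mul_eq_one_comm.1 h1
      rw [← map_mul] at h1 h2
      refine ⟨isoPoints.mk x (baseMatrix_injective inj R (h1.trans (map_one _).symm))
        (baseMatrix_injective inj R (h2.trans (map_one _).symm)), ?_⟩
      exact Subtype.ext (Subtype.ext hx)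

/-- The case γ = 1 of `spCentralizer_iso`: the identity is centralized by everything. -/
theorem iso_sympAnti (a : ℕ) : Nonempty (Iso (sympAnti F (Fin a)) ≅ Sp F a) := by
  obtain ⟨e⟩ := spCentralizer_iso (τ := sympAnti F (Fin a)) 1 (AlgHom.id F _)
    Function.injective_id (fun g => ⟨fun _ => Commute.one_left g, fun _ => ⟨g, rfl⟩⟩)
    (fun _ => rfl)
  have h : Nonempty (spCentralizer (1 : Matrix.symplecticGroup (Fin a) F) ≅ Sp F a) := by
    refine nonempty_iso_of_bijective (fun R => Subgroup.subtype _) (fun _ _ => rfl) ?_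
    intro R
    have h (g : Matrix.symplecticGroup (Fin a) R) :
        g ∈ Subgroup.centralizer {spMap a (algebraMap F R) 1} := by
      rw [map_one, Subgroup.mem_centralizer_singleton_iff, mul_one, one_mul]
    exact ⟨Subtype.val_injective, fun g => ⟨⟨g, h g⟩, rfl⟩⟩
  exact ⟨e.trans h.some⟩

end centralizer

/-! ### The unitary and linear isometry groups as Weil restrictions -/

section matrixTensor

variable {F L : Type u} [CommRing F] [CommRing L] [Algebra F L]

/-- The isomorphism `R ⊗ M_b(L) ≃ M_b(R ⊗ L)`. -/
noncomputable def matrixTensor (L : Type u) [CommRing L] [Algebra F L] (b : ℕ) (R : Type u)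
    [CommRing R] [Algebra F R] :
    R ⊗[F] Matrix (Fin b) (Fin b) L ≃ₐ[F] Matrix (Fin b) (Fin b) (R ⊗[F] L) :=
  AlgEquiv.ofLinearEquiv
    ((TensorProduct.piRight F F R fun _ : Fin b => Fin b → L) ≪≫ₗ
      LinearEquiv.piCongrRight fun _ => TensorProduct.piRight F F R fun _ : Fin b => L)
    (by
      ext i j
      change (1 : R) ⊗ₜ[F] (1 : Matrix (Fin b) (Fin b) L) i j = _
      rcases eq_or_ne i j with rfl | h
      · rw [Matrix.one_apply_eq, Matrix.one_apply_eq, Algebra.TensorProduct.one_def]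
      · rw [Matrix.one_apply_ne h, Matrix.one_apply_ne h, TensorProduct.tmul_zero])
    (LinearMap.map_mul_of_map_mul_tmul fun r s g h => by
      ext i j
      change (r * s) ⊗ₜ[F] ((g * h) i j) = ∑ k, (r ⊗ₜ[F] g i k) * (s ⊗ₜ[F] h k j)
      simp only [Matrix.mul_apply, TensorProduct.tmul_sum, Algebra.TensorProduct.tmul_mul_tmul])

end matrixTensor

section unitary

variable {F K L : Type u} [CommRing F] [CommRing K] [CommRing L] [Algebra F K] [Algebra F L]
  [Algebra K L] [IsScalarTower F K L]

/-- The conjugate transpose `g ↦ σ(g)ᵀ`. -/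
def conjAnti (F : Type u) {K L : Type u} [CommRing F] [CommRing K] [CommRing L] [Algebra F K]
    [Algebra F L] [Algebra K L] [IsScalarTower F K L] (σ : L ≃ₐ[K] L) (b : ℕ) :
    AntiHom F (Matrix (Fin b) (Fin b) L) where
  toFun g := (g.map σ).transpose
  map_add' g h := by ext; simp
  map_smul' c g := by
    ext i j
    exact map_smul (σ.restrictScalars F) c (g j i)
  map_one := by simp
  map_mul g h := by rw [Matrix.map_mul, Matrix.transpose_mul]

variable (F K L) in
/-- The isomorphism `R ⊗ L ≃ L ⊗[K] (K ⊗[F] R)`. -/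
noncomputable def tensorSwap (R : Type u) [CommRing R] [Algebra F R] :
    R ⊗[F] L ≃ₐ[F] L ⊗[K] (K ⊗[F] R) :=
  (Algebra.TensorProduct.comm F R L).trans
    ((Algebra.TensorProduct.cancelBaseChange F K K L R).symm.restrictScalars F)

/-- The isomorphism `R ⊗ M_b(L) ≃ M_b(L ⊗[K] (K ⊗[F] R))`. -/
noncomputable def unitaryEquiv (F K L : Type u) [CommRing F] [CommRing K] [CommRing L]
    [Algebra F K] [Algebra F L] [Algebra K L] [IsScalarTower F K L] (b : ℕ)
    (R : Type u) [CommRing R] [Algebra F R] :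
    R ⊗[F] Matrix (Fin b) (Fin b) L ≃ₐ[F] Matrix (Fin b) (Fin b) (L ⊗[K] (K ⊗[F] R)) :=
  (matrixTensor L b R).trans (tensorSwap F K L R).mapMatrix

theorem unitaryEquiv_base (σ : L ≃ₐ[K] L) (b : ℕ) (R : Type u) [CommRing R] [Algebra F R]
    (x : R ⊗[F] Matrix (Fin b) (Fin b) L) :
    unitaryEquiv F K L b R ((conjAnti F σ b).base R x) =
      ((unitaryEquiv F K L b R x).map (tensorConj σ (K ⊗[F] R))).transpose := by
  induction x with
  | zero => ext; simp
  | add x y hx hy => ext; simp [hx, hy]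
  | tmul r g => rfl

theorem unitaryEquiv_map (b : ℕ) {R S : Type u} [CommRing R] [Algebra F R] [CommRing S]
    [Algebra F S] (φ : R →ₐ[F] S) (x : R ⊗[F] Matrix (Fin b) (Fin b) L) :
    unitaryEquiv F K L b S (Algebra.TensorProduct.map φ (AlgHom.id F _) x) =
      (unitaryEquiv F K L b R x).map (tensorMap L (tensorMap K φ)) := by
  induction x with
  | zero => ext; simp
  | add x y hx hy => ext; simp [hx, hy]
  | tmul r g => rfl

/-- After the identification R ⊗ L ≃ L ⊗[K] (K ⊗[F] R), the base change of the conjugate transpose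
is the conjugate transpose for σ ⊗ id, so the two defining equations coincide. -/
theorem iso_conjAnti (σ : L ≃ₐ[K] L) (b : ℕ) :
    Nonempty (Iso (conjAnti F σ b) ≅ Res F (U σ b)) := by
  refine nonempty_iso_of_bijective (fun R =>
    ((Units.map (unitaryEquiv F K L b R : _ →* _)).comp
      (isoPoints (conjAnti F σ b) R).subtype).codRestrict (unitaryPoints σ b (K ⊗[F] R))
      fun g => ?_) ?_ ?_
  · change ((unitaryEquiv F K L b R g.1.val).map (tensorConj σ (K ⊗[F] R))).transpose *
      (unitaryEquiv F K L b R g.1.val) = 1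
    rw [← unitaryEquiv_base, ← map_mul, mem_isoPoints.1 g.2, map_one]
  · intro R S f g
    exact Subtype.ext (Units.ext (unitaryEquiv_map b f.hom _))
  · intro R
    constructor
    · intro g h H
      exact isoPoints_ext ((unitaryEquiv F K L b R).injective (congrArg (fun z => z.1.val) H))
    · intro g
      have h1 : (g.1.val.map (tensorConj σ (K ⊗[F] R))).transpose * g.1.val = 1 := g.2
      obtain ⟨x, hx⟩ := (unitaryEquiv F K L b R).surjective g.1.val
      rw [← hx, ← unitaryEquiv_base] at h1
      have h2 := mul_eq_one_comm.1 h1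
      rw [← map_mul] at h1 h2
      refine ⟨isoPoints.mk x ((unitaryEquiv F K L b R).injective (h1.trans (map_one _).symm))
        ((unitaryEquiv F K L b R).injective (h2.trans (map_one _).symm)), ?_⟩
      exact Subtype.ext (Units.ext hx)

end unitary

section linear

variable {F M : Type u} [CommRing F] [CommRing M] [Algebra F M]

/-- The antimultiplicative map `(g, h) ↦ (hᵀ, gᵀ)`. -/
def swapAnti (F M : Type u) [CommRing F] [CommRing M] [Algebra F M] (c : ℕ) :
    AntiHom F (Matrix (Fin c) (Fin c) M × Matrix (Fin c) (Fin c) M) where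
  toFun g := (g.2.transpose, g.1.transpose)
  map_add' g h := rfl
  map_smul' a g := rfl
  map_one := by simp
  map_mul g h := by simp [Matrix.transpose_mul]

/-- A pair (g, h) is an isometry exactly when h is the inverse transpose of g, so projection to the
first component is an isomorphism onto GL. -/
theorem iso_swapAnti (c : ℕ) :
    Nonempty (Iso (swapAnti F M c) ≅ Res F (GLn M c)) := by
  let A := Matrix (Fin c) (Fin c) M
  let e (R : Type u) [CommRing R] [Algebra F R] :
      R ⊗[F] A ≃ₐ[F] Matrix (Fin c) (Fin c) (M ⊗[F] R) :=
    (matrixTensor M c R).trans (Algebra.TensorProduct.comm F R M).mapMatrix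
  let p (R : Type u) [CommRing R] [Algebra F R] :
      R ⊗[F] (A × A) →ₐ[F] Matrix (Fin c) (Fin c) (M ⊗[F] R) :=
    (e R).toAlgHom.comp (Algebra.TensorProduct.map (AlgHom.id F R) (AlgHom.fst F A A))
  let q (R : Type u) [CommRing R] [Algebra F R] :
      R ⊗[F] (A × A) →ₐ[F] Matrix (Fin c) (Fin c) (M ⊗[F] R) :=
    (e R).toAlgHom.comp (Algebra.TensorProduct.map (AlgHom.id F R) (AlgHom.snd F A A))
  have hp : ∀ (R : Type u) [CommRing R] [Algebra F R] (x : R ⊗[F] (A × A)),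
      p R ((swapAnti F M c).base R x) = (q R x).transpose := by
    intro R _ _ x
    induction x with
    | zero => simp
    | add x y hx hy => simp [hx, hy]
    | tmul r a => rfl
  have hq : ∀ (R : Type u) [CommRing R] [Algebra F R] (x : R ⊗[F] (A × A)),
      q R ((swapAnti F M c).base R x) = (p R x).transpose := by
    intro R _ _ x
    induction x with
    | zero => simp
    | add x y hx hy => simp [hx, hy]
    | tmul r a => rfl
  have hpq : ∀ (R : Type u) [CommRing R] [Algebra F R],
      Function.Bijective fun x => (p R x, q R x) := by
    intro R _ _
    have h : (fun x => (p R x, q R x)) =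
        Prod.map (e R) (e R) ∘ (Algebra.TensorProduct.prodRight F F R A A) := by
      funext x
      induction x with
      | zero =>
        rw [Function.comp_apply, map_zero]
        exact Prod.ext ((map_zero (p R)).trans (map_zero (e R)).symm)
          ((map_zero (q R)).trans (map_zero (e R)).symm)
      | add x y hx hy =>
        rw [Function.comp_apply, map_add]
        simp only [Function.comp_apply, Prod.ext_iff, Prod.map_fst,
          Prod.map_snd] at hx hy
        refine Prod.ext ?_ ?_
        · simp only [map_add, hx.1, hy.1, Prod.map_fst, Prod.fst_add]
        · simp only [map_add, hx.2, hy.2, Prod.map_snd, Prod.snd_add]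
      | tmul r a => rfl
    rw [h]
    exact ((e R).bijective.prodMap (e R).bijective).comp (AlgEquiv.bijective _)
  refine nonempty_iso_of_bijective (fun R =>
    (Units.map (p R : _ →* _)).comp (isoPoints (swapAnti F M c) R).subtype) ?_ ?_
  · intro R S f g
    apply Units.ext
    change p S (Algebra.TensorProduct.map f.hom (AlgHom.id F (A × A)) g.1.val) =
      (p R g.1.val).map (tensorMap M f.hom)
    generalize g.1.val = x
    induction x with
    | zero => ext; simp
    | add x y hx hy => ext; simp [hx, hy]
    | tmul r a => rfl
  · intro R
    have key : ∀ g : isoPoints (swapAnti F M c) R,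
        (q R g.1.val).transpose * p R g.1.val = 1 := by
      intro g
      rw [← hp, ← map_mul, mem_isoPoints.1 g.2, map_one]
    constructor
    · intro g h H
      have H1 : p R g.1.val = p R h.1.val := congrArg Units.val H
      have H2 : (q R g.1.val).transpose = (q R h.1.val).transpose := by
        have h1 := key g
        have h2 := mul_eq_one_comm.1 (key h)
        rw [H1] at h1
        rw [← Matrix.mul_one (q R g.1.val).transpose, ← h2, ← Matrix.mul_assoc, h1,
          Matrix.one_mul]
      exact isoPoints_ext ((hpq R).1 (Prod.ext H1 (Matrix.transpose_injective H2)))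
    · intro g
      -- The second component is forced to be the inverse transpose.
      obtain ⟨x, hx⟩ := (hpq R).2 (g.val, (g⁻¹).val.transpose)
      have hx1 : p R x = g.val := congrArg Prod.fst hx
      have hx2 : q R x = (g⁻¹).val.transpose := congrArg Prod.snd hx
      refine ⟨isoPoints.mk x ((hpq R).1 (Prod.ext ?_ ?_)) ((hpq R).1 (Prod.ext ?_ ?_)),
        Units.ext hx1⟩
      · change p R _ = p R _
        rw [map_mul, hp, map_one, hx1, hx2, Matrix.transpose_transpose]
        exact Units.inv_mul g
      · change q R _ = q R _
        rw [map_mul, hq, map_one, hx1, hx2, ← Matrix.transpose_mul]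
        rw [show (g⁻¹).val * g.val = 1 from Units.inv_mul g, Matrix.transpose_one]
      · change p R _ = p R _
        rw [map_mul, hp, map_one, hx1, hx2, Matrix.transpose_transpose]
        exact Units.mul_inv g
      · change q R _ = q R _
        rw [map_mul, hq, map_one, hx1, hx2, ← Matrix.transpose_mul]
        rw [show g.val * (g⁻¹).val = 1 from Units.mul_inv g, Matrix.transpose_one]

end linear

end AlgGrp

/-! ### Symplectic bases -/

section alternating

variable {F : Type*} [Field F]

/-- A nondegenerate alternating form has a maximal symplectic system. -/
theorem exists_symplectic_system (n : ℕ) {W : Type*} [AddCommGroup W] [Module F W]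
    [FiniteDimensional F W] (hn : Module.finrank F W = n) (B : W →ₗ[F] W →ₗ[F] F)
    (alt : ∀ v, B v v = 0) (nd : ∀ v, (∀ w, B v w = 0) → v = 0) :
    ∃ (a : ℕ) (e f : Fin a → W), (∀ i j, B (e i) (e j) = 0) ∧ (∀ i j, B (f i) (f j) = 0) ∧
      (∀ i j, B (f i) (e j) = if i = j then 1 else 0) ∧
      ∀ w, (∀ i, B (e i) w = 0) → (∀ i, B (f i) w = 0) → w = 0 := by
  induction n using Nat.strong_induction_on generalizing W with
  | _ n ih =>
  have skew : ∀ v w, B v w = -B w v := fun v w => by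
    have := alt (v + w)
    simp only [map_add, LinearMap.add_apply, alt, zero_add, add_zero] at this
    exact eq_neg_of_add_eq_zero_right this
  rcases subsingleton_or_nontrivial W with hW | hW
  · exact ⟨0, Fin.elim0, Fin.elim0, fun i => i.elim0, fun i => i.elim0, fun i => i.elim0,
      fun w _ _ => Subsingleton.elim _ _⟩
  · obtain ⟨v, hv⟩ := exists_ne (0 : W)
    -- The value -1 matches the sign of the upper right block of `Matrix.J`.
    obtain ⟨w, hw⟩ : ∃ w, B v w = -1 := by
      by_contra! H
      refine hv (nd v fun w => ?_)
      by_contra hvw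
      refine H (-(B v w)⁻¹ • w) ?_
      rw [map_smul, smul_eq_mul, neg_mul, inv_mul_cancel₀ hvw]
    have hwv : B w v = 1 := by rw [skew, hw, neg_neg]
    let U : Submodule F W := LinearMap.ker (B v) ⊓ LinearMap.ker (B w)
    have memU : ∀ x, x ∈ U ↔ B v x = 0 ∧ B w x = 0 := fun x => Iff.rfl
    have hvU : v ∉ U := fun h => by
      rw [memU, hwv] at h
      exact one_ne_zero h.2
    have hlt : Module.finrank F U < n := by
      rw [← hn]
      exact Submodule.finrank_lt fun h => hvU (h ▸ Submodule.mem_top)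
    -- Projection onto the orthogonal complement of the hyperbolic plane spanned by v and w; it also
    -- transfers nondegeneracy to that complement.
    have hU : ∀ y, y + (B v y) • w - (B w y) • v ∈ U := fun y => by
      rw [memU]
      simp [alt, hw, hwv]
    obtain ⟨a, e, f, hee, hff, hfe, hc⟩ := ih _ hlt rfl (B.domRestrict₁₂ U U)
      (fun x => alt _) (fun x hx => Subtype.ext (nd _ fun y => by
        have h1 := hx ⟨_, hU y⟩
        simp only [LinearMap.domRestrict₁₂_apply, map_add, map_sub, map_smul,
          skew x.1 v, skew x.1 w, ((memU _).1 x.2).1, ((memU _).1 x.2).2] at h1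
        simpa using h1))
    have hve : ∀ u : U, B v u = 0 := fun u => ((memU _).1 u.2).1
    have hwe : ∀ u : U, B w u = 0 := fun u => ((memU _).1 u.2).2
    refine ⟨a + 1, Fin.cons v fun i => (e i : W), Fin.cons w fun i => (f i : W), ?_, ?_, ?_, ?_⟩
    · intro i j
      refine Fin.cases ?_ (fun i => ?_) i <;> refine Fin.cases ?_ (fun j => ?_) j
      · simp [alt]
      · simp [hve]
      · simp [skew _ v, hve]
      · exact hee i j
    · intro i j
      refine Fin.cases ?_ (fun i => ?_) i <;> refine Fin.cases ?_ (fun j => ?_) j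
      · simp [alt]
      · simp [hwe]
      · simp [skew _ w, hwe]
      · exact hff i j
    · intro i j
      refine Fin.cases ?_ (fun i => ?_) i <;> refine Fin.cases ?_ (fun j => ?_) j
      · simp [hwv]
      · simp [hwe, (Fin.succ_ne_zero j).symm]
      · simp [skew _ v, hve]
      · simp only [Fin.cons_succ, Fin.succ_inj]
        exact hfe i j
    · intro x h1 h2
      have hx : x ∈ U := (memU x).2 ⟨h1 0, h2 0⟩
      exact congrArg Subtype.val
        (hc ⟨x, hx⟩ (fun i => h1 i.succ) fun i => h2 i.succ)

/-- A nondegenerate alternating form has a symplectic basis. -/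
theorem exists_symplectic_basis {W : Type*} [AddCommGroup W] [Module F W]
    [FiniteDimensional F W] (B : W →ₗ[F] W →ₗ[F] F)
    (alt : ∀ v, B v v = 0) (nd : ∀ v, (∀ w, B v w = 0) → v = 0) :
    ∃ (a : ℕ) (b : Module.Basis (Fin a ⊕ Fin a) F W),
      ∀ i j, B (b i) (b j) = Matrix.J (Fin a) F i j := by
  have skew : ∀ v w, B v w = -B w v := fun v w => by
    have := alt (v + w)
    simp only [map_add, LinearMap.add_apply, alt, zero_add, add_zero] at this
    exact eq_neg_of_add_eq_zero_right this
  obtain ⟨a, e, f, hee, hff, hfe, hc⟩ := exists_symplectic_system _ rfl B alt nd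
  have hef : ∀ i j, B (e i) (f j) = if i = j then -1 else 0 := fun i j => by
    rw [skew, hfe]
    rcases eq_or_ne i j with rfl | h
    · simp
    · simp [h, h.symm]
  have hli : LinearIndependent F (Sum.elim e f) := by
    rw [Fintype.linearIndependent_iff]
    intro g hg
    rw [Fintype.sum_sum_type] at hg
    simp only [Sum.elim_inl, Sum.elim_inr] at hg
    rintro (i | i)
    · have := congrArg (B (f i)) hg
      simpa [hff, hfe] using this
    · have := congrArg (B (e i)) hg
      simpa [hee, hef] using this
  have hsp : ⊤ ≤ Submodule.span F (Set.range (Sum.elim e f)) := by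
    intro w _
    -- The difference of w and its expected expansion is orthogonal to the whole system, so vanishes
    -- by maximality.
    have hw : w - ((∑ i, B (f i) w • e i) + ∑ i, (-B (e i) w) • f i) = 0 := by
      apply hc
      · intro i
        simp [hee, hef]
      · intro i
        simp [hff, hfe]
    rw [sub_eq_zero.1 hw]
    refine add_mem (sum_mem fun i _ => Submodule.smul_mem _ _ (Submodule.subset_span ?_))
      (sum_mem fun i _ => Submodule.smul_mem _ _ (Submodule.subset_span ?_))
    · exact ⟨Sum.inl i, rfl⟩
    · exact ⟨Sum.inr i, rfl⟩
  refine ⟨a, Module.Basis.mk hli hsp, ?_⟩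
  rintro (i | i) (j | j)
  · simp [hee, Matrix.J]
  · simp [hef, Matrix.J, Matrix.one_apply, apply_ite]
  · simp [hfe, Matrix.J, Matrix.one_apply]
  · simp [hff, Matrix.J]

end alternating

/-! ### Orthonormal bases of Hermitian forms -/

section hermitian

variable {L : Type*} [Field L] (σ : L →+* L)

/-- A nondegenerate Hermitian form has a maximal orthonormal system, if all fixed elements
are norms. -/
theorem exists_orthonormal_system (hne : ∃ x, σ x ≠ x)
    (hnorm : ∀ a, σ a = a → ∃ c, c * σ c = a) (n : ℕ) {W : Type*} [AddCommGroup W] [Module L W]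
    [FiniteDimensional L W] (hn : Module.finrank L W = n) (h : W → Module.Dual L W)
    (herm : ∀ v w, h w v = σ (h v w)) (nd : ∀ v, (∀ w, h v w = 0) → v = 0) :
    ∃ (m : ℕ) (e : Fin m → W), (∀ i j, h (e i) (e j) = if i = j then 1 else 0) ∧
      ∀ w, (∀ i, h (e i) w = 0) → w = 0 := by
  induction n using Nat.strong_induction_on generalizing W with
  | _ n ih =>
  -- Only linearity in the second variable is built into h; semilinearity in the first follows from
  -- Hermitian symmetry.
  have hadd : ∀ x y z, h (x + y) z = h x z + h y z := fun x y z => by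
    rw [herm z, map_add, map_add, ← herm, ← herm]
  have hsmul : ∀ c x z, h (c • x) z = σ c * h x z := fun c x z => by
    rw [herm z, map_smul, smul_eq_mul, map_mul, ← herm]
  rcases subsingleton_or_nontrivial W with hW | hW
  · exact ⟨0, Fin.elim0, fun i => i.elim0, fun w _ => Subsingleton.elim _ _⟩
  · obtain ⟨v, hv⟩ : ∃ v, h v v ≠ 0 := by
      by_contra! H
      obtain ⟨x, hx⟩ := exists_ne (0 : W)
      obtain ⟨y, hy⟩ : ∃ y, h x y ≠ 0 := by
        by_contra! H'
        exact hx (nd x H')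
      -- Polarization: were all h(v, v) zero, evaluating at x + c h(x, y)⁻¹ y would give c + σ(c) =
      -- 0 for every c. Taking c = 1 gives characteristic two, and then σ would be the identity.
      have key : ∀ c, c + σ c = 0 := fun c => by
        have := H (x + (c * (h x y)⁻¹) • y)
        rw [hadd, map_add, map_add, H, hsmul _ _ ((c * (h x y)⁻¹) • y), map_smul (h y), H,
          herm x, map_smul] at this
        simpa [hy] using this
      obtain ⟨c, hc⟩ := hne
      apply hc
      have h1 := key 1
      rw [map_one] at h1
      have h2 : c + c = 0 := by rw [← mul_one c, ← mul_add, h1, mul_zero]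
      rw [eq_neg_of_add_eq_zero_right (key c), eq_neg_of_add_eq_zero_right h2]
      simp [← eq_neg_of_add_eq_zero_right h2]
    -- The value h(v, v) is fixed by σ, hence a norm c σ(c), and c⁻¹ v has length 1.
    obtain ⟨c, hc⟩ := hnorm (h v v) (herm v v).symm
    have hc0 : c ≠ 0 := by
      rintro rfl
      rw [zero_mul] at hc
      exact hv hc.symm
    have hσc : σ c ≠ 0 := (map_ne_zero σ).2 hc0
    obtain ⟨u, hu⟩ : ∃ u, h u u = 1 := by
      refine ⟨c⁻¹ • v, ?_⟩
      rw [hsmul, map_smul, smul_eq_mul, ← hc, map_inv₀]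
      field_simp
    let U : Submodule L W := LinearMap.ker (h u)
    have memU : ∀ x, x ∈ U ↔ h u x = 0 := fun x => Iff.rfl
    have huU : u ∉ U := fun H => by
      rw [memU, hu] at H
      exact one_ne_zero H
    have hlt : Module.finrank L U < n := by
      rw [← hn]
      exact Submodule.finrank_lt fun H => huU (H ▸ Submodule.mem_top)
    have hU : ∀ y, y - (h u y) • u ∈ U := fun y => by
      rw [memU]
      simp [hu]
    obtain ⟨m, e, hee, hc⟩ := ih _ hlt rfl (fun x : U => (h x.1).domRestrict U)
      (fun x y => herm _ _) (fun x hx => Subtype.ext (nd _ fun y => by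
        have h1 := hx ⟨_, hU y⟩
        have h2 : h x.1 u = 0 := by rw [herm u, (memU _).1 x.2, map_zero]
        simpa [h2] using h1))
    have hue : ∀ x : U, h u x = 0 := fun x => (memU _).1 x.2
    refine ⟨m + 1, Fin.cons u fun i => (e i : W), ?_, ?_⟩
    · intro i j
      refine Fin.cases ?_ (fun i => ?_) i <;> refine Fin.cases ?_ (fun j => ?_) j
      · simp [hu]
      · simp [hue, (Fin.succ_ne_zero j).symm]
      · simp [herm u, hue]
      · simpa using hee i j
    · intro x h1
      have hx : x ∈ U := (memU x).2 (h1 0)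
      exact congrArg Subtype.val (hc ⟨x, hx⟩ fun i => h1 i.succ)

/-- A nondegenerate Hermitian form has an orthonormal basis, if all fixed elements are norms. -/
theorem exists_orthonormal_basis (hne : ∃ x, σ x ≠ x)
    (hnorm : ∀ a, σ a = a → ∃ c, c * σ c = a) {W : Type*} [AddCommGroup W] [Module L W]
    [FiniteDimensional L W] {n : ℕ} (hn : Module.finrank L W = n) (h : W → Module.Dual L W)
    (herm : ∀ v w, h w v = σ (h v w)) (nd : ∀ v, (∀ w, h v w = 0) → v = 0) :
    ∃ b : Module.Basis (Fin n) L W, ∀ i j, h (b i) (b j) = if i = j then 1 else 0 := by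
  obtain ⟨m, e, hee, hc⟩ := exists_orthonormal_system σ hne hnorm _ rfl h herm nd
  have hli : LinearIndependent L e := by
    rw [Fintype.linearIndependent_iff]
    intro g hg i
    have := congrArg (h (e i)) hg
    simpa [hee] using this
  have hsp : ⊤ ≤ Submodule.span L (Set.range e) := by
    intro w _
    have hw : w - (∑ i, h (e i) w • e i) = 0 := by
      apply hc
      intro i
      simp [hee]
    rw [sub_eq_zero.1 hw]
    exact sum_mem fun i _ => Submodule.smul_mem _ _ (Submodule.subset_span ⟨i, rfl⟩)
  obtain rfl : m = n := by
    rw [← hn, Module.finrank_eq_card_basis (Module.Basis.mk hli hsp), Fintype.card_fin]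
  exact ⟨Module.Basis.mk hli hsp, by simpa using hee⟩

end hermitian

/-! ### Adjoints in adapted bases; transfer from alternating to Hermitian forms -/

section adjoint

/-- In a symplectic basis, the adjoint of an endomorphism is given by `sympAnti`. -/
theorem exists_basis_adjoint_sympAnti {F : Type u} [Field F] {W : Type*} [AddCommGroup W]
    [Module F W] [FiniteDimensional F W] (B : W →ₗ[F] W →ₗ[F] F)
    (alt : ∀ v, B v v = 0) (nd : ∀ v, (∀ w, B v w = 0) → v = 0) :
    ∃ (a : ℕ) (b : Module.Basis (Fin a ⊕ Fin a) F W), ∀ g v w,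
      B (Matrix.toLin b b g v) w =
        B v (Matrix.toLin b b ((AlgGrp.sympAnti F (Fin a)).toLinearMap g) w) := by
  obtain ⟨a, b, hb⟩ := exists_symplectic_basis B alt nd
  refine ⟨a, b, fun g v w => ?_⟩
  have key : ∀ v w, B v w = b.repr v ⬝ᵥ (Matrix.J (Fin a) F).mulVec (b.repr w) := by
    intro v w
    conv_lhs => rw [← b.sum_repr v]
    rw [map_sum, LinearMap.sum_apply, dotProduct]
    refine Finset.sum_congr rfl fun i _ => ?_
    conv_lhs => rw [← b.sum_repr w]
    rw [map_smul, LinearMap.smul_apply, smul_eq_mul, map_sum, Matrix.mulVec, dotProduct]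
    congr 1
    refine Finset.sum_congr rfl fun j _ => ?_
    rw [map_smul, hb, smul_eq_mul, mul_comm]
  rw [key, key, Matrix.repr_toLin, Matrix.repr_toLin, AlgGrp.sympAnti_apply,
    Matrix.mulVec_mulVec, Matrix.mul_neg, ← Matrix.mul_assoc, ← Matrix.mul_assoc,
    Matrix.J_squared]
  simp only [Matrix.neg_mul, Matrix.one_mul, neg_neg]
  rw [← Matrix.mulVec_mulVec, Matrix.dotProduct_mulVec _ g.transpose, Matrix.vecMul_transpose]

/-- Let `L` be a finite separable extension of `F` with an involution `σ`. For an alternating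
form with `B(λv, w) = B(v, σ(λ)w)` on an `L`-space there is a basis in which the adjoint is given
by the conjugate transpose. -/
theorem exists_basis_adjoint_conj {F L : Type*} [Field F] [Field L] [Algebra F L]
    [FiniteDimensional F L] [Algebra.IsSeparable F L] (σ : L →ₐ[F] L)
    (hσ : ∀ x, σ (σ x) = x) (hne : ∃ x, σ x ≠ x)
    (hnorm : ∀ a, σ a = a → ∃ c, c * σ c = a)
    {W : Type*} [AddCommGroup W] [Module F W] [Module L W] [IsScalarTower F L W]
    [FiniteDimensional L W] {n : ℕ} (hn : Module.finrank L W = n) (B : W →ₗ[F] W →ₗ[F] F)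
    (alt : ∀ v, B v v = 0) (nd : ∀ v, (∀ w, B v w = 0) → v = 0)
    (hB : ∀ (c : L) v w, B (c • v) w = B v (σ c • w)) :
    ∃ b : Module.Basis (Fin n) L W, ∀ g v w,
      B (Matrix.toLin b b g v) w = B v (Matrix.toLin b b (g.map σ).transpose w) := by
  have skew : ∀ v w, B v w = -B w v := fun v w => by
    have := alt (v + w)
    simp only [map_add, LinearMap.add_apply, alt, zero_add, add_zero] at this
    exact eq_neg_of_add_eq_zero_right this
  have tr := traceForm_nondegenerate F L
  have tσ : ∀ x, Algebra.trace F L (σ x) = Algebra.trace F L x := fun x =>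
    Algebra.trace_eq_of_algEquiv (AlgEquiv.ofBijective σ
      ⟨σ.injective, fun y => ⟨σ y, hσ y⟩⟩) x
  have tinj : ∀ x y : L, (∀ c, Algebra.trace F L (c * x) = Algebra.trace F L (c * y)) → x = y := by
    intro x y hxy
    rw [← sub_eq_zero]
    refine tr.2 _ fun c => ?_
    rw [Algebra.traceForm_apply, mul_sub, map_sub, hxy, sub_self]
  -- By nondegeneracy of the trace form, the functional c ↦ B(v, c w) on L is c ↦ Tr(c h(v, w)) for
  -- a unique h(v, w).
  have ex : ∀ v w, ∃ x : L, ∀ c, Algebra.trace F L (c * x) = B v (c • w) := by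
    intro v w
    let ℓ : Module.Dual F L :=
      { toFun c := B v (c • w)
        map_add' c d := by rw [add_smul, map_add]
        map_smul' a c := by rw [smul_assoc, map_smul, RingHom.id_apply] }
    refine ⟨((Algebra.traceForm F L).toDual tr).symm ℓ, fun c => ?_⟩
    have := LinearMap.BilinForm.apply_toDual_symm_apply (hB := tr) ℓ c
    rw [Algebra.traceForm_apply, mul_comm] at this
    exact this
  choose h hh using ex
  obtain ⟨x, hx⟩ := hne
  -- The form h is skew-Hermitian because B is skew; multiplying by δ with σ(δ) = -δ makes it
  -- Hermitian, also in characteristic two.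
  let δ := x - σ x
  have hδ0 : δ ≠ 0 := sub_ne_zero.2 hx.symm
  have hδ : σ δ = -δ := by simp [δ, hσ]
  let h' : W → Module.Dual L W := fun v =>
    { toFun w := δ * h v w
      map_add' w w' := by
        rw [← mul_add]
        congr 1
        refine tinj _ _ fun c => ?_
        rw [mul_add, map_add, hh, hh, hh, smul_add, map_add]
      map_smul' a w := by
        rw [RingHom.id_apply, smul_eq_mul, mul_left_comm a]
        congr 1
        refine tinj _ _ fun c => ?_
        rw [← mul_assoc, hh, hh, smul_smul] }
  have hh' : ∀ v w, B v w = Algebra.trace F L (δ⁻¹ * h' v w) := fun v w => by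
    change _ = Algebra.trace F L (δ⁻¹ * (δ * h v w))
    rw [inv_mul_cancel_left₀ hδ0, ← one_mul (h v w), hh, one_smul]
  have herm : ∀ v w, h' w v = σ (h' v w) := fun v w => by
    change δ * h w v = σ (δ * h v w)
    rw [map_mul, hδ, neg_mul, ← mul_neg]
    congr 1
    -- Tr(c h(w, v)) = B(w, c v) = -B(c v, w) = -B(v, σ(c) w) = -Tr(σ(c) h(v, w)) = -Tr(c σ(h(v,
    -- w))).
    refine tinj _ _ fun c => ?_
    rw [hh, mul_neg, map_neg, ← hσ c, ← map_mul, tσ, hh, hσ, skew, ← hσ c, ← hB, hσ]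
  obtain ⟨b, hb⟩ := exists_orthonormal_basis (σ : L →+* L) ⟨x, hx⟩ hnorm hn h' herm fun v hv =>
    nd v fun w => by rw [hh', hv, mul_zero, map_zero]
  clear_value h'
  have hadd : ∀ z x y, h' (x + y) z = h' x z + h' y z := fun z x y => by
    rw [herm z, map_add, map_add, ← herm, ← herm]
  have hsmul : ∀ c x z, h' (c • x) z = σ c * h' x z := fun c x z => by
    rw [herm z, map_smul, smul_eq_mul, map_mul, ← herm]
  have hb' : ∀ i w, h' (b i) w = b.repr w i := fun i w => by
    conv_lhs => rw [← b.sum_repr w, map_sum]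
    simp [hb]
  have hb'' : ∀ v w, h' v w = ∑ i, σ (b.repr v i) * b.repr w i := fun v w => by
    conv_lhs => rw [← b.sum_repr v]
    refine (map_sum (AddMonoidHom.mk' (fun x => h' x w) (hadd w)) _ _).trans ?_
    simp [hsmul, hb']
  refine ⟨b, fun g v w => ?_⟩
  rw [hh', hh']
  congr 2
  rw [hb'', hb'', Matrix.repr_toLin, Matrix.repr_toLin]
  simp only [Matrix.mulVec, dotProduct, Matrix.transpose_apply, Matrix.map_apply, map_sum, map_mul,
    Finset.sum_mul, Finset.mul_sum]
  rw [Finset.sum_comm]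
  exact Finset.sum_congr rfl fun i _ => Finset.sum_congr rfl fun j _ => by ring

/-- Fixed elements of an involution of a finite field are norms. -/
theorem exists_mul_conj_eq {K L : Type*} [Field K] [Field L] [Algebra K L] [Finite L]
    (h2 : Module.finrank K L = 2) (σ : L ≃ₐ[K] L) (hσ : σ ≠ AlgEquiv.refl) :
    (∀ x, σ (σ x) = x) ∧ ∀ a, σ a = a → ∃ c, c * σ c = a := by
  have := Finite.of_injective _ (algebraMap K L).injective
  have hcard : Nat.card (L ≃ₐ[K] L) = 2 := by rw [IsGalois.card_aut_eq_finrank, h2]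
  have huniv : ∀ g : L ≃ₐ[K] L, g = 1 ∨ g = σ := by
    intro g
    have := (Nat.card_eq_two_iff' (1 : L ≃ₐ[K] L)).1 hcard
    obtain ⟨y, hy, hy'⟩ := this
    by_cases hg : g = 1
    · exact Or.inl hg
    · exact Or.inr ((hy' g hg).trans (hy' σ hσ).symm)
  have hσσ : σ * σ = 1 := by
    rcases huniv (σ * σ) with h | h
    · exact h
    · exact absurd (mul_eq_left.1 h) hσ
  have hinv : ∀ x, σ (σ x) = x := fun x => DFunLike.congr_fun hσσ x
  refine ⟨hinv, fun a ha => ?_⟩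
  -- The Galois group is {1, σ}, so an element fixed by σ lies in K; the norm of finite fields is
  -- surjective, and here it is c ↦ c σ(c).
  have hfix : a ∈ Set.range (algebraMap K L) := by
    rw [IsGalois.mem_range_algebraMap_iff_fixed]
    intro g
    rcases huniv g with rfl | rfl
    · rfl
    · exact ha
  obtain ⟨k, rfl⟩ := hfix
  obtain ⟨c, rfl⟩ := FiniteField.norm_surjective K L k
  refine ⟨c, ?_⟩
  rw [Algebra.norm_eq_prod_automorphisms]
  classical
  have : ∀ I : Fintype (L ≃ₐ[K] L), @Finset.univ _ I = {1, σ} := by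
    intro I
    ext g
    simpa using huniv g
  have h1σ : (1 : L ≃ₐ[K] L) ≠ σ := fun h => hσ h.symm
  rw [this, Finset.prod_pair h1σ]
  rfl

end adjoint

/-! ### Projections onto primary parts -/

section proj

variable {F E : Type*} [Field F] [Ring E] [Algebra F E]

/-- `e` is the projection onto the `f`-primary part of `γ` (for `f` prime to its cofactor in a
polynomial annihilating `γ`). -/
structure IsProj (γ : E) (f : F[X]) (e : E) : Prop where
  comm : ∀ g, Commute γ g → Commute e g
  kill : aeval γ f * e = 0
  -- Together with `kill`, this makes e the identity on everything killed by f(γ), and it pins e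
  -- down uniquely without reference to a cofactor.
  compl : ∃ s, Commute γ s ∧ 1 - e = s * aeval γ f

theorem commute_aeval {γ g : E} (h : Commute γ g) (p : F[X]) : Commute (aeval γ p) g := by
  induction p using Polynomial.induction_on' with
  | add p q hp hq => rw [map_add]; exact hp.add_left hq
  | monomial n a =>
    rw [aeval_monomial]
    exact Commute.mul_left (Algebra.commutes a g) (h.pow_left n)

/-- With a Bézout relation s f + t g = 1, the projection is (t g)(γ) and its complement is (s f)(γ).
-/
theorem exists_isProj {γ : E} {f g : F[X]} (h : aeval γ (f * g) = 0) (hc : IsCoprime f g) :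
    ∃ e, IsProj γ f e := by
  obtain ⟨s, t, hst⟩ := hc
  refine ⟨aeval γ (t * g), fun x hx => commute_aeval hx _, ?_, aeval γ s,
    (commute_aeval (Commute.refl γ) s).symm, ?_⟩
  · rw [← map_mul, mul_left_comm, map_mul, h, mul_zero]
  · rw [← map_mul, ← map_one (aeval (R := F) γ), ← hst, map_add, add_sub_cancel_right]

namespace IsProj

variable {γ : E} {f f' : F[X]} {e e' : E}

theorem commute_self (h : IsProj γ f e) : Commute γ e := (h.comm γ (Commute.refl γ)).symm

theorem kill' (h : IsProj γ f e) : e * aeval γ f = 0 := by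
  rw [(h.comm _ (commute_aeval (Commute.refl γ) f).symm).eq, h.kill]

theorem idem (h : IsProj γ f e) : e * e = e := by
  obtain ⟨s, hs, h1⟩ := h.compl
  have : e * (1 - e) = 0 := by
    rw [h1, ← mul_assoc, (h.comm s hs).eq, mul_assoc, h.kill', mul_zero]
  rw [mul_sub, mul_one, sub_eq_zero] at this
  exact this.symm

theorem orth (h : IsProj γ f e) (h' : IsProj γ f' e') (hc : IsCoprime f f') : e * e' = 0 := by
  obtain ⟨a, b, hab⟩ := hc
  have h1 : e * e' = e * aeval γ (a * f + b * f') * e' := by rw [hab, map_one, mul_one]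
  rw [h1, map_add, map_mul, map_mul, mul_add, add_mul]
  have c : Commute e (aeval γ a) := h.comm _ (commute_aeval (Commute.refl γ) a).symm
  rw [← mul_assoc e, c.eq, mul_assoc _ e, h.kill', mul_zero, zero_mul, zero_add, mul_assoc,
    mul_assoc, h'.kill, mul_zero, mul_zero]

/-- This is how adjoints of projections are identified: adj(e) is a projection for the reciprocal
polynomial, hence equals the one already chosen. -/
theorem unique (h : IsProj γ f e) (h' : IsProj γ f e') : e = e' := by
  have key : ∀ {e e' : E}, IsProj γ f e → IsProj γ f e' → e = e * e' := by
    intro e e' h h'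
    obtain ⟨s, hs, h1⟩ := h'.compl
    have : e * (1 - e') = 0 := by
      rw [h1, ← mul_assoc, (h.comm s hs).eq, mul_assoc, h.kill', mul_zero]
    rw [mul_sub, mul_one, sub_eq_zero] at this
    exact this
  rw [key h h', (h.comm e' h'.commute_self).eq, ← key h' h]

theorem C_mul (h : IsProj γ f e) {c : F} (hc : c ≠ 0) : IsProj γ (C c * f) e := by
  obtain ⟨s, hs, h1⟩ := h.compl
  refine ⟨h.comm, ?_, c⁻¹ • s, hs.smul_right _, ?_⟩
  · rw [map_mul, mul_assoc, h.kill, mul_zero]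
  · rw [h1, map_mul, aeval_C, ← Algebra.smul_def, smul_mul_smul_comm, inv_mul_cancel₀ hc, one_smul]

theorem eq_zero_of_one (h : IsProj γ (1 : F[X]) e) : e = 0 := by
  have := h.kill
  rwa [map_one, one_mul] at this

theorem sum_eq_one {ι : Type*} [Fintype ι] {f : ι → F[X]} {e : ι → E}
    (h : ∀ i, IsProj γ (f i) (e i)) (hc : Pairwise fun i j => IsCoprime (f i) (f j))
    (h0 : aeval γ (∏ i, f i) = 0) : ∑ i, e i = 1 := by
  classical
  set z := 1 - ∑ i, e i with hz
  have hcomm : ∀ g, Commute γ g → Commute z g := fun g hg =>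
    (Commute.one_left g).sub_left (Commute.sum_left _ _ _ fun i _ => (h i).comm g hg)
  have hze : ∀ i, z * e i = 0 := fun i => by
    rw [hz, sub_mul, one_mul, Finset.sum_mul, Finset.sum_eq_single i, (h i).idem, sub_self]
    · exact fun j _ hj => (h j).orth (h i) (hc hj)
    · simp
  -- Since z kills each e i, z = z (1 - e i) is divisible by f i (γ); peeling off one factor at a
  -- time makes z divisible by the whole product, which vanishes at γ.
  have key : ∀ S : Finset ι, ∃ t, z = t * aeval γ (∏ i ∈ S, f i) := by
    intro S
    induction S using Finset.induction_on with
    | empty => exact ⟨z, by simp⟩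
    | insert i S hi ih =>
      obtain ⟨t, ht⟩ := ih
      obtain ⟨s, hs, h1⟩ := (h i).compl
      refine ⟨t * s, ?_⟩
      have h2 : z = z * (1 - e i) := by rw [mul_sub, mul_one, hze, sub_zero]
      rw [Finset.prod_insert hi, mul_comm (f i), map_mul, mul_assoc, ← mul_assoc s,
        ← (commute_aeval hs _).eq, mul_assoc, ← h1, ← mul_assoc, ← ht]
      exact h2
  obtain ⟨t, ht⟩ := key Finset.univ
  rw [h0, mul_zero] at ht
  rw [← sub_eq_zero, ← neg_sub, ← hz, ht, neg_zero]

end IsProj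

theorem aeval_reverse_eq {γ γ' : E} (h : γ * γ' = 1) (f : F[X]) :
    aeval γ f.reverse = γ ^ f.natDegree * aeval γ' f := by
  rw [aeval_eq_sum_range' (Nat.lt_succ_of_le (reverse_natDegree_le f)), aeval_eq_sum_range,
    Finset.mul_sum, ← Finset.sum_range_reflect]
  refine Finset.sum_congr rfl fun i hi => ?_
  have hi' : i ≤ f.natDegree := Nat.lt_succ_iff.1 (Finset.mem_range.1 hi)
  have h1 : f.natDegree.succ - 1 - i = f.natDegree - i := by omega
  have h2 : ∀ i, γ ^ i * γ' ^ i = 1 := fun i => by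
    induction i with
    | zero => simp
    | succ i ih => rw [pow_succ, pow_succ', mul_assoc, ← mul_assoc γ, h, one_mul, ih]
  rw [Nat.succ_eq_add_one, add_tsub_cancel_right, coeff_reverse, revAt_le (Nat.sub_le _ _),
    Nat.sub_sub_self hi', mul_smul_comm]
  congr 1
  calc γ ^ (f.natDegree - i) = γ ^ (f.natDegree - i) * (γ ^ i * γ' ^ i) := by rw [h2, mul_one]
    _ = γ ^ f.natDegree * γ' ^ i := by rw [← mul_assoc, ← pow_add, Nat.sub_add_cancel hi']

/-- An involutive antiautomorphism maps the projection for `f` to that for the reverse of `f`. -/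
theorem IsProj.adj {γ γ' e : E} {f : F[X]} (h : IsProj γ f e) (adj : E →ₗ[F] E)
    (adj_one : adj 1 = 1) (adj_mul : ∀ x y, adj (x * y) = adj y * adj x)
    (adj_adj : ∀ x, adj (adj x) = x)
    (hγ : adj γ = γ') (h1 : γ * γ' = 1) (h2 : γ' * γ = 1) : IsProj γ f.reverse (adj e) := by
  have hinv : ∀ g, Commute γ g → Commute γ' g := fun g hg => by
    calc γ' * g = γ' * g * (γ * γ') := by rw [h1, mul_one]
      _ = γ' * (γ * g) * γ' := by rw [hg.eq]; simp only [mul_assoc]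
      _ = g * γ' := by rw [← mul_assoc, h2, one_mul]
  have hinv' : ∀ g, Commute γ' g → Commute γ g := fun g hg => by
    calc γ * g = γ * g * (γ' * γ) := by rw [h2, mul_one]
      _ = γ * (γ' * g) * γ := by rw [hg.eq]; simp only [mul_assoc]
      _ = g * γ := by rw [← mul_assoc, h1, one_mul]
  have hadj : ∀ {x y}, Commute x y → Commute (adj x) (adj y) := fun {x y} hxy => by
    change adj x * adj y = adj y * adj x
    rw [← adj_mul, ← adj_mul, hxy.eq]
  have hcomm : ∀ g, Commute γ g → Commute γ (adj g) := fun g hg =>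
    hinv' _ (hγ ▸ hadj hg)
  have hpow : ∀ n, adj (γ ^ n) = γ' ^ n := fun n => by
    induction n with
    | zero => simpa using adj_one
    | succ n ih => rw [pow_succ, adj_mul, ih, hγ, ← pow_succ']
  have haev : ∀ p : F[X], adj (aeval γ p) = aeval γ' p := fun p => by
    rw [aeval_eq_sum_range, aeval_eq_sum_range, map_sum]
    exact Finset.sum_congr rfl fun i _ => by rw [map_smul, hpow]
  have hp : ∀ n, γ' ^ n * γ ^ n = 1 := fun n => by
    induction n with
    | zero => simp
    | succ i ih => rw [pow_succ, pow_succ', mul_assoc, ← mul_assoc γ', h2, one_mul, ih]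
  obtain ⟨s, hs, hse⟩ := h.compl
  have hγγ' : Commute γ γ' := h1.trans h2.symm
  -- At γ the reverse of f is γ^(deg f) f(γ⁻¹), and f(γ⁻¹) = adj(f(γ)); the power of γ⁻¹ in the
  -- witness cancels the power of γ.
  refine ⟨fun g hg => ?_, ?_, γ' ^ f.natDegree * adj s, ?_, ?_⟩
  · have := hadj (h.comm (adj g) (hcomm g hg))
    rwa [adj_adj] at this
  · rw [aeval_reverse_eq h1, mul_assoc, ← haev, ← adj_mul, h.kill', map_zero, mul_zero]
  · exact (hγγ'.pow_right _).mul_right (hcomm s hs)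
  · have c : Commute (adj s) (aeval γ f.reverse) := (commute_aeval (hcomm s hs) _).symm
    rw [mul_assoc, c.eq, aeval_reverse_eq h1, ← mul_assoc, ← mul_assoc, hp, one_mul, ← haev,
      ← adj_mul, ← hse, map_sub, adj_one]

end proj

/-! ### Dimensions of primary parts from the characteristic polynomial -/

section dimension

theorem aeval_restrict_apply {F V : Type*} [Field F] [AddCommGroup V] [Module F V]
    {φ : Module.End F V} {U : Submodule F V} (hU : ∀ x ∈ U, φ x ∈ U)
    (p : F[X]) (x : U) : ((aeval (φ.restrict hU) p x : U) : V) = aeval φ p x := by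
  have hpow : ∀ n (x : U), (((φ.restrict hU) ^ n) x : V) = (φ ^ n) x := by
    intro n
    induction n with
    | zero => simp
    | succ n ih => intro x; rw [pow_succ, pow_succ, Module.End.mul_apply, ih]; rfl
  rw [aeval_eq_sum_range, aeval_eq_sum_range]
  simp [LinearMap.sum_apply, hpow]

variable {F V : Type*} [Field F] [AddCommGroup V] [Module F V] [FiniteDimensional F V]

/-- An irreducible factor of the characteristic polynomial of `δ` does not evaluate to an
injective endomorphism at `δ`. -/
theorem not_injective_aeval_of_dvd_charpoly {δ : Module.End F V} {g : F[X]} (hg : Irreducible g)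
    (h : g ∣ δ.charpoly) : ¬ Function.Injective (aeval δ g) := by
  classical
  have : Fact (Irreducible g) := ⟨hg⟩
  let b := Module.finBasis F V
  let M := LinearMap.toMatrix b b δ
  -- Over K the root of g is an eigenvalue of the matrix. An eigenvector for it is killed by g of
  -- the matrix, so the determinant of g(δ) becomes zero in K, hence is zero in F.
  let K := AdjoinRoot g
  let MK : Matrix _ _ K := M.map (algebraMap F K)
  let φ : Matrix (Fin (Module.finrank F V)) (Fin (Module.finrank F V)) F →ₐ[F]
      Matrix (Fin (Module.finrank F V)) (Fin (Module.finrank F V)) K :=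
    (Algebra.ofId F K).mapMatrix
  have hφ : φ M = MK := rfl
  have h0 : (Matrix.scalar _ (AdjoinRoot.root g) - MK).det = 0 := by
    rw [← Matrix.eval_charpoly, Matrix.charpoly_map, LinearMap.charpoly_toMatrix]
    obtain ⟨q, hq⟩ := h
    rw [hq, Polynomial.map_mul, Polynomial.eval_mul, Polynomial.eval_map, AdjoinRoot.algebraMap_eq,
      AdjoinRoot.eval₂_root, zero_mul]
  obtain ⟨v, hv, hv0⟩ := Matrix.exists_mulVec_eq_zero_iff.2 h0
  have hMv : MK.mulVec v = AdjoinRoot.root g • v := by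
    rw [Matrix.sub_mulVec, sub_eq_zero, Matrix.scalar_apply] at hv0
    rw [← hv0]
    ext i
    simp [Matrix.mulVec_diagonal]
  have hpow : ∀ n, (MK ^ n).mulVec v = (AdjoinRoot.root g) ^ n • v := by
    intro n
    induction n with
    | zero => simp
    | succ n ih =>
      rw [pow_succ, ← Matrix.mulVec_mulVec, hMv, Matrix.mulVec_smul, ih, smul_smul, ← pow_succ']
  have hgv : (aeval MK g).mulVec v = 0 := by
    rw [aeval_eq_sum_range, Matrix.sum_mulVec]
    simp only [Matrix.smul_mulVec, hpow]
    have : ∑ i ∈ Finset.range (g.natDegree + 1),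
        g.coeff i • AdjoinRoot.root g ^ i • v = (aeval (AdjoinRoot.root g) g) • v := by
      rw [aeval_eq_sum_range, Finset.sum_smul]
      exact Finset.sum_congr rfl fun i _ => (smul_assoc _ _ _).symm
    rw [this, AdjoinRoot.aeval_eq, AdjoinRoot.mk_self, zero_smul]
  have hdet : (aeval M g).det = 0 := by
    have h1 : (aeval MK g).det = 0 := Matrix.exists_mulVec_eq_zero_iff.1 ⟨v, hv, hgv⟩
    rw [← hφ, aeval_algHom_apply] at h1
    have h2 : (φ (aeval M g)).det = algebraMap F K (aeval M g).det :=
      (RingHom.map_det (algebraMap F K) _).symm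
    rw [h2] at h1
    exact (map_eq_zero_iff _ (algebraMap F K).injective).1 h1
  have hdet' : LinearMap.det (aeval δ g) = 0 := by
    rw [← LinearMap.det_toMatrix b]
    have h3 : LinearMap.toMatrixAlgEquiv b (aeval δ g) = aeval M g :=
      (aeval_algHom_apply (LinearMap.toMatrixAlgEquiv b).toAlgHom δ g).symm
    rw [← hdet, ← h3]
    rfl
  intro hinj
  have hu : IsUnit (aeval δ g) := by
    rw [Module.End.isUnit_iff]
    exact ⟨hinj, LinearMap.injective_iff_surjective.1 hinj⟩
  exact (hu.map LinearMap.det).ne_zero hdet'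

theorem charpoly_eq_mul_of_isCompl {φ : Module.End F V} {U W : Submodule F V} (h : IsCompl U W)
    (hU : ∀ x ∈ U, φ x ∈ U) (hW : ∀ x ∈ W, φ x ∈ W) :
    φ.charpoly = (φ.restrict hU).charpoly * (φ.restrict hW).charpoly := by
  let e := Submodule.prodEquivOfIsCompl U W h
  have hψ : (φ.restrict hU).prodMap (φ.restrict hW) = e.symm.conj φ := by
    apply LinearMap.ext
    rintro ⟨x, y⟩
    apply e.injective
    change e _ = e (e.symm (φ (e (x, y))))
    rw [LinearEquiv.apply_symm_apply]
    simp only [e, LinearMap.prodMap_apply, Submodule.coe_prodEquivOfIsCompl', map_add,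
      LinearMap.coe_restrict_apply]
  rw [← e.symm.charpoly_conj φ, ← hψ, LinearMap.charpoly_prodMap]

/-- The dimension of a primary part is read off from the characteristic polynomial. -/
theorem IsProj.finrank_range {γ e : Module.End F V} {f g : F[X]} (h : IsProj γ f e)
    (hf : Irreducible f) {m : ℕ} (hm : γ.charpoly = f ^ m * g) (hfg : ¬ f ∣ g) :
    Module.finrank F (LinearMap.range e) = m * f.natDegree := by
  have he : ∀ x, x ∈ LinearMap.range e ↔ e x = x := fun x =>
    ⟨fun ⟨y, hy⟩ => by rw [← hy, ← Module.End.mul_apply, h.idem], fun hx => ⟨x, hx⟩⟩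
  have hcomm : ∀ x, e (γ x) = γ (e x) := fun x => (LinearMap.congr_fun h.commute_self.eq x).symm
  have hU : ∀ x ∈ LinearMap.range e, γ x ∈ LinearMap.range e := fun x hx => by
    rw [he] at *
    rw [hcomm, hx]
  have hW : ∀ x ∈ LinearMap.ker e, γ x ∈ LinearMap.ker e := fun x hx => by
    rw [LinearMap.mem_ker] at *
    rw [hcomm, hx, map_zero]
  have hcompl : IsCompl (LinearMap.range e) (LinearMap.ker e) := by
    constructor
    · rw [Submodule.disjoint_def]
      intro x hx hx'
      rw [← (he x).1 hx, LinearMap.mem_ker.1 hx']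
    · rw [codisjoint_iff, eq_top_iff]
      intro x _
      rw [Submodule.mem_sup]
      refine ⟨e x, ⟨x, rfl⟩, x - e x, ?_, add_sub_cancel _ _⟩
      rw [LinearMap.mem_ker, map_sub, ← Module.End.mul_apply, h.idem, sub_self]
  have hprod := charpoly_eq_mul_of_isCompl hcompl hU hW
  set γ₁ := γ.restrict hU
  set γ₂ := γ.restrict hW
  have hγ₁ : aeval γ₁ f = 0 := by
    ext x
    rw [aeval_restrict_apply, ← (he x).1 x.2, ← Module.End.mul_apply, h.kill]
    rfl
  have hγ₂ : ¬ f ∣ γ₂.charpoly := fun hd => by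
    refine not_injective_aeval_of_dvd_charpoly hf hd ?_
    rw [← LinearMap.ker_eq_bot, LinearMap.ker_eq_bot']
    intro x hx
    obtain ⟨s, hs, hse⟩ := h.compl
    have h1 := LinearMap.congr_fun hse x.1
    have h2 : aeval γ f x.1 = 0 := by rw [← aeval_restrict_apply hW, hx]; rfl
    rw [Module.End.mul_apply, h2, map_zero, LinearMap.sub_apply, LinearMap.mem_ker.1 x.2,
      sub_zero] at h1
    exact Subtype.ext h1
  have hfin : FiniteMultiplicity f γ₁.charpoly :=
    FiniteMultiplicity.of_not_isUnit hf.not_isUnit γ₁.charpoly_monic.ne_zero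
  obtain ⟨c, hc, hfc⟩ := hfin.exists_eq_pow_mul_and_not_dvd
  set k := multiplicity f γ₁.charpoly
  -- On the range of e the characteristic polynomial is a power of f up to a unit: any other
  -- irreducible factor q is prime to f, which kills γ₁, so q(γ₁) would be invertible.
  have hcu : IsUnit c := by
    by_contra hcu
    have hc0 : c ≠ 0 := by
      rintro rfl
      exact hfc (dvd_zero f)
    obtain ⟨q, hq, hqc⟩ := WfDvdMonoid.exists_irreducible_factor hcu hc0
    have hcop : IsCoprime q f := by
      rw [hq.coprime_iff_not_dvd]
      intro hqf
      exact hfc ((hq.associated_of_dvd hf hqf).symm.dvd.trans hqc)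
    refine not_injective_aeval_of_dvd_charpoly (δ := γ₁) hq (hc ▸ hqc.mul_left _) ?_
    obtain ⟨a, b, hab⟩ := hcop
    have h1 : aeval γ₁ a * aeval γ₁ q = 1 := by
      rw [← map_mul, ← map_one (aeval (R := F) γ₁), ← hab, map_add, map_mul _ b, hγ₁, mul_zero, add_zero]
    exact Function.LeftInverse.injective (g := aeval γ₁ a) fun x => LinearMap.congr_fun h1 x
  have hp := hf.prime
  have hfin : f ^ m * g = f ^ k * (c * γ₂.charpoly) := by
    rw [← hm, hprod, hc, mul_assoc]
  have hnd : ¬ f ∣ c * γ₂.charpoly := fun hd => (hp.dvd_or_dvd hd).elim hfc hγ₂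
  -- On the kernel of e, f(γ) is injective, so f does not divide the complementary factor and the
  -- whole multiplicity of f sits in the range.
  have hmk : m = k := by
    apply le_antisymm
    · exact (pow_dvd_pow_iff hf.ne_zero hf.not_isUnit).1
        (hp.pow_dvd_of_dvd_mul_right m hnd (hfin ▸ Dvd.intro _ rfl))
    · exact (pow_dvd_pow_iff hf.ne_zero hf.not_isUnit).1
        (hp.pow_dvd_of_dvd_mul_right k hfg (hfin ▸ Dvd.intro _ rfl))
  rw [← LinearMap.charpoly_natDegree γ₁, hc, natDegree_mul (pow_ne_zero _ hf.ne_zero) hcu.ne_zero,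
    natDegree_pow, natDegree_eq_zero_of_isUnit hcu, add_zero, hmk]

end dimension

/-! ### Reciprocal polynomials -/

section reciprocal

variable {F : Type u} [Field F]

theorem reverse_reverse_of_coeff_zero_ne {f : F[X]} (h : f.coeff 0 ≠ 0) : f.reverse.reverse = f := by
  have hd : f.reverse.natDegree = f.natDegree := by
    rw [reverse_natDegree, natTrailingDegree_eq_zero.2 (Or.inr h), Nat.sub_zero]
  ext n
  rw [coeff_reverse, coeff_reverse, hd, revAt_invol]

theorem natDegree_reverse_of_coeff_zero_ne {f : F[X]} (h : f.coeff 0 ≠ 0) :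
    f.reverse.natDegree = f.natDegree := by
  rw [reverse_natDegree, natTrailingDegree_eq_zero.2 (Or.inr h), Nat.sub_zero]

theorem trailingCoeff_of_coeff_zero_ne {f : F[X]} (h : f.coeff 0 ≠ 0) :
    f.trailingCoeff = f.coeff 0 := by
  rw [trailingCoeff, natTrailingDegree_eq_zero.2 (Or.inr h)]

theorem monic_reciprocalPoly {f : F[X]} (h : f.coeff 0 ≠ 0) : f.reciprocalPoly.Monic := by
  rw [Monic, reciprocalPoly, leadingCoeff_mul, leadingCoeff_C, reverse_leadingCoeff,
    trailingCoeff_of_coeff_zero_ne h, inv_mul_cancel₀ h]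

theorem coeff_zero_reciprocalPoly {f : F[X]} (hf : f.Monic) :
    f.reciprocalPoly.coeff 0 = (f.coeff 0)⁻¹ := by
  rw [reciprocalPoly, coeff_C_mul, coeff_zero_reverse, hf, mul_one]

theorem reciprocalPoly_reciprocalPoly {f : F[X]} (hf : f.Monic) (h : f.coeff 0 ≠ 0) :
    f.reciprocalPoly.reciprocalPoly = f := by
  rw [reciprocalPoly, coeff_zero_reciprocalPoly hf, reciprocalPoly, reverse_mul_of_domain,
    reverse_C, reverse_reverse_of_coeff_zero_ne h, inv_inv, ← mul_assoc, ← C_mul,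
    mul_inv_cancel₀ h, C_1, one_mul]

theorem coeff_zero_ne_of_reciprocalPoly_eq {f : F[X]} (hf : f.Monic) (h : f.reciprocalPoly = f) :
    f.coeff 0 ≠ 0 := by
  intro h0
  rw [reciprocalPoly, h0, inv_zero, C_0, zero_mul] at h
  exact hf.ne_zero h.symm

theorem irreducible_reciprocalPoly {f : F[X]} (hf : Irreducible f) (h : f.coeff 0 ≠ 0) :
    Irreducible f.reciprocalPoly := by
  have hassoc : Associated f.reciprocalPoly f.reverse :=
    (associated_isUnit_mul_left_iff (isUnit_C.2 (inv_ne_zero h).isUnit)).2 (Associated.refl _)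
  rw [hassoc.irreducible_iff]
  refine ⟨fun hu => hf.not_isUnit ?_, fun a b hab => ?_⟩
  · have := natDegree_eq_zero_of_isUnit hu
    rw [natDegree_reverse_of_coeff_zero_ne h] at this
    rw [isUnit_iff_degree_eq_zero, degree_eq_natDegree hf.ne_zero, this]
    rfl
  · have h1 : f = a.reverse * b.reverse := by
      rw [← reverse_mul_of_domain, ← hab, reverse_reverse_of_coeff_zero_ne h]
    have h0 : a.coeff 0 * b.coeff 0 ≠ 0 := by
      rw [← mul_coeff_zero, ← hab, coeff_zero_reverse]
      exact leadingCoeff_ne_zero.2 hf.ne_zero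
    have key : ∀ {c : F[X]}, c.coeff 0 ≠ 0 → IsUnit c.reverse → IsUnit c := fun {c} hc hu => by
      have := natDegree_eq_zero_of_isUnit hu
      rw [natDegree_reverse_of_coeff_zero_ne hc] at this
      have hc0 : c ≠ 0 := by
        rintro rfl
        exact hc (coeff_zero 0)
      rw [isUnit_iff_degree_eq_zero, degree_eq_natDegree hc0, this]
      rfl
    exact (hf.isUnit_or_isUnit h1).imp (key (left_ne_zero_of_mul h0)) (key (right_ne_zero_of_mul h0))

/-- Reversal is multiplicative over a field, so it carries divisors of a palindromic polynomial to
divisors. Applied twice, it shows that f and f* have the same multiplicity. -/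
theorem reciprocalPoly_pow_dvd {f p : F[X]} (h : f.coeff 0 ≠ 0) (hp : p.reverse = p) {n : ℕ}
    (hd : f ^ n ∣ p) : f.reciprocalPoly ^ n ∣ p := by
  have hrev : ∀ n, (f ^ n).reverse = f.reverse ^ n := fun n => by
    induction n with
    | zero => simpa using reverse_C (1 : F)
    | succ n ih => rw [pow_succ, reverse_mul_of_domain, ih, pow_succ]
  obtain ⟨g, hg⟩ := hd
  have h1 : f.reverse ^ n ∣ p := by
    rw [← hp, hg, reverse_mul_of_domain, hrev]
    exact dvd_mul_right _ _
  rw [reciprocalPoly, mul_pow]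
  exact ((isUnit_C.2 (inv_ne_zero h).isUnit).pow n).mul_left_dvd.2 h1

theorem reciprocalPoly_X_sub_C {c : F} (hc : c * c = 1) :
    (X - C c : F[X]).reciprocalPoly = X - C c := by
  have hc0 : c ≠ 0 := left_ne_zero_of_mul_eq_one hc
  have h0 : (X - C c : F[X]).coeff 0 = -c := by simp
  have h1 : (X - C c : F[X]).reverse = 1 - C c * X := by
    rw [sub_eq_add_neg, ← C_neg, reverse_add_C, natDegree_X, pow_one]
    have : (X : F[X]).reverse = 1 := by
      have := reverse_mul_X (1 : F[X])
      rw [one_mul] at this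
      rw [this]
      simpa using reverse_C (1 : F)
    rw [this, C_neg]
    ring
  rw [reciprocalPoly, h0, h1, inv_neg, inv_eq_of_mul_eq_one_left hc, mul_sub, mul_one, ← mul_assoc,
    ← C_mul, neg_mul, hc]
  simp
  ring

end reciprocal

/-! ### Finite fields generated by a root, and their involutions -/

section fields

variable {F : Type u} [Field F] [Finite F]

/-- A finite extension of the right degree contains a generating root of an irreducible
polynomial. -/
theorem exists_root_surjective {M : Type u} [Field M] [Algebra F M] {f : F[X]}
    (hf : f.Monic) (hi : Irreducible f) (hM : Module.finrank F M = f.natDegree) :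
    ∃ α : M, minpoly F α = f ∧ Function.Surjective (aeval α : F[X] →ₐ[F] M) := by
  have : Fact (Irreducible f) := ⟨hi⟩
  have hpos : 0 < f.natDegree := hi.natDegree_pos
  have : Module.Finite F M := Module.finite_of_finrank_pos (hM ▸ hpos)
  have : Finite M := Module.finite_of_finite F
  have : Module.Finite F (AdjoinRoot f) := (AdjoinRoot.powerBasis hi.ne_zero).finite
  have hM' : Module.finrank F (AdjoinRoot f) = f.natDegree := by
    rw [(AdjoinRoot.powerBasis hi.ne_zero).finrank, AdjoinRoot.powerBasis_dim]
  have : NeZero f.natDegree := ⟨hpos.ne'⟩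
  obtain ⟨p, hp⟩ := CharP.exists F
  have : Fact p.Prime := ⟨CharP.char_is_prime F p⟩
  -- Extensions of a finite field of equal degree are isomorphic; the root in `AdjoinRoot f` is
  -- transported to M.
  let ψ : AdjoinRoot f ≃ₐ[F] M :=
    (FiniteField.algEquivExtension F p f.natDegree _ hM').trans
      (FiniteField.algEquivExtension F p f.natDegree _ hM).symm
  have hα : minpoly F (ψ (AdjoinRoot.root f)) = f := by
    rw [minpoly.algEquiv_eq, AdjoinRoot.minpoly_root hi.ne_zero, hf.leadingCoeff, inv_one, C_1,
      mul_one]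
  refine ⟨ψ (AdjoinRoot.root f), hα, ?_⟩
  intro x
  obtain ⟨q, hq⟩ := AdjoinRoot.mk_surjective (ψ.symm x)
  refine ⟨q, ?_⟩
  rw [← AdjoinRoot.aeval_eq] at hq
  exact (aeval_algHom_apply ψ.toAlgHom _ q).trans (by rw [hq]; exact ψ.apply_symm_apply x)

/-- The involution `α ↦ α⁻¹` of the field generated by a root `α` of a self-reciprocal polynomial. -/
theorem exists_inversion {L : Type u} [Field L] [Algebra F L] [FiniteDimensional F L] {f : F[X]}
    (hf : f.Monic) (hr : f.reciprocalPoly = f) (h1 : f ≠ X - 1) (h2 : f ≠ X + 1) {α : L}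
    (hα : minpoly F α = f) (hs : Function.Surjective (aeval α : F[X] →ₐ[F] L)) :
    ∃ ρ : L ≃ₐ[F] L, ρ α = α⁻¹ ∧ ρ * ρ = 1 ∧ ρ ≠ 1 := by
  have : Finite L := Module.finite_of_finite F
  have h0 := coeff_zero_ne_of_reciprocalPoly_eq hf hr
  have hα0 : α ≠ 0 := by
    rintro rfl
    rw [minpoly.zero] at hα
    rw [← hα] at h0
    simp at h0
  -- The inverse α⁻¹ is a root of f* = f, hence a conjugate of α.
  have hroot : aeval α⁻¹ (minpoly F α) = 0 := by
    rw [hα, ← hr, reciprocalPoly, map_mul, aeval_reverse_eq (inv_mul_cancel₀ hα0), ← hα,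
      minpoly.aeval, mul_zero, mul_zero]
  obtain ⟨ρ, hρ⟩ := minpoly.exists_algEquiv_of_root
    (Algebra.IsAlgebraic.isAlgebraic α) hroot
  replace hρ : ρ α = α⁻¹ := by rw [← inv_inv (ρ α), ← map_inv₀, hρ]
  refine ⟨ρ, hρ, ?_, ?_⟩
  · ext x
    obtain ⟨q, rfl⟩ := hs x
    have h3 : ∀ y, ρ (aeval y q) = aeval (ρ y) q := fun y =>
      (aeval_algHom_apply ρ.toAlgHom y q).symm
    rw [AlgEquiv.mul_apply, h3, h3, hρ, map_inv₀, hρ, inv_inv]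
    rfl
  -- If inversion were trivial, α² = 1 and f would be one of the excluded polynomials X ∓ 1.
  · rintro rfl
    have h3 : α = α⁻¹ := hρ
    have h4 : (α - 1) * (α + 1) = 0 := by
      have : α * α = 1 := by
        nth_rewrite 2 [h3]
        exact mul_inv_cancel₀ hα0
      linear_combination this
    rcases mul_eq_zero.1 h4 with h | h
    · apply h1
      rw [← hα, sub_eq_zero.1 h, ← map_one (algebraMap F L), minpoly.eq_X_sub_C, C_1]
    · apply h2
      rw [← hα, eq_neg_of_add_eq_zero_left h, ← map_one (algebraMap F L), ← map_neg,
        minpoly.eq_X_sub_C, C_neg, C_1, sub_neg_eq_add]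

/-- Inversion is an element of order 2 in the Galois group of the field generated by a root, whose
order is the degree of f. -/
theorem exists_natDegree_eq_two_mul {f : F[X]} (hf : f.Monic) (hi : Irreducible f)
    (hr : f.reciprocalPoly = f) (h1 : f ≠ X - 1) (h2 : f ≠ X + 1) :
    ∃ d, 0 < d ∧ f.natDegree = 2 * d := by
  have : Fact (Irreducible f) := ⟨hi⟩
  have : Module.Finite F (AdjoinRoot f) := (AdjoinRoot.powerBasis hi.ne_zero).finite
  have : Finite (AdjoinRoot f) := Module.finite_of_finite F
  have hM' : Module.finrank F (AdjoinRoot f) = f.natDegree := by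
    rw [(AdjoinRoot.powerBasis hi.ne_zero).finrank, AdjoinRoot.powerBasis_dim]
  obtain ⟨α, hα, hs⟩ := exists_root_surjective hf hi hM'
  obtain ⟨ρ, -, hρ, hρ1⟩ := exists_inversion hf hr h1 h2 hα hs
  have hord : orderOf ρ = 2 := orderOf_eq_prime (by rw [pow_two, hρ]) hρ1
  have hdvd : 2 ∣ f.natDegree := by
    rw [← hM', ← IsGalois.card_aut_eq_finrank, ← hord]
    exact orderOf_dvd_natCard ρ
  obtain ⟨d, hd⟩ := hdvd
  exact ⟨d, by have := hi.natDegree_pos; omega, hd⟩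

/-- An involution of a finite field is unique. -/
theorem involution_unique {L : Type u} [Field L] [Algebra F L] [FiniteDimensional F L]
    {ρ σ : L ≃ₐ[F] L} (hρ : ρ * ρ = 1) (hρ1 : ρ ≠ 1) (hσ : σ * σ = 1) (hσ1 : σ ≠ 1) : ρ = σ := by
  classical
  have : Finite L := Module.finite_of_finite F
  by_contra hne
  have := Fintype.ofFinite (L ≃ₐ[F] L)
  -- The Galois group is cyclic, so at most two of its elements square to 1.
  have h := IsCyclic.card_pow_eq_one_le (α := L ≃ₐ[F] L) (n := 2) two_pos
  have hsub : ({1, ρ, σ} : Finset (L ≃ₐ[F] L)) ⊆ Finset.univ.filter fun a => a ^ 2 = 1 := by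
    intro x hx
    simp only [Finset.mem_insert, Finset.mem_singleton] at hx
    simp only [Finset.mem_filter, Finset.mem_univ, true_and, pow_two]
    rcases hx with rfl | rfl | rfl
    · exact mul_one 1
    · exact hρ
    · exact hσ
  have h3 := (Finset.card_le_card hsub).trans h
  rw [Finset.card_eq_three.2 ⟨1, ρ, σ, hρ1.symm, hσ1.symm, hne, rfl⟩] at h3
  omega

end fields

/-! ### Palindromic characteristic polynomials and existence of the factorization -/

section charpoly

/-- The characteristic polynomial of a symplectic matrix is palindromic. -/
theorem reverse_charpoly_of_mem_symplecticGroup {F : Type u} [Field F] {n : ℕ}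
    (γ : Matrix.symplecticGroup (Fin n) F) :
    (γ.1.charpoly).reverse = γ.1.charpoly := by
  have hdet := SymplecticGroup.det_eq_one γ.2
  have hu : IsUnit γ.1 := (Matrix.isUnit_iff_isUnit_det _).2 (by rw [hdet]; exact isUnit_one)
  have h1 := Matrix.charpoly_inv γ.1 hu
  -- The inverse is conjugate by J to the transpose, so γ⁻¹ and γ have the same characteristic
  -- polynomial; the determinant is 1, so no scalar intervenes.
  have h2 : γ.1⁻¹ = (-Matrix.J (Fin n) F * γ.1.transpose) * Matrix.J (Fin n) F := by
    apply Matrix.inv_eq_left_inv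
    have := AlgGrp.mem_symplecticGroup_iff_sympAnti.1 γ.2
    simpa [AlgGrp.sympAnti_apply] using this
  rw [h2, Matrix.charpoly_mul_comm, ← Matrix.mul_assoc, Matrix.mul_neg, Matrix.J_squared, neg_neg,
    Matrix.one_mul, Matrix.charpoly_transpose, hdet] at h1
  rw [Matrix.reverse_charpoly]
  simpa using h1.symm

end charpoly

section factorization

variable {F : Type u} [Field F]

open UniqueFactorizationMonoid in
/-- A palindromic monic polynomial with even multiplicities at `±1` has a symplectic
factorization. -/
theorem nonempty_symplecticFactorization {p : F[X]} (hp : p.Monic) (hr : p.reverse = p)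
    (heven : ∀ c : F, c * c = 1 → ∀ k g, p = (X - C c) ^ k * g → ¬ (X - C c) ∣ g → Even k) :
    Nonempty (SymplecticFactorization p) := by
  classical
  have hp0 : p ≠ 0 := hp.ne_zero
  have hc0 : p.coeff 0 = 1 := by
    rw [← hr, coeff_zero_reverse]
    exact hp
  let m : F[X] → ℕ := fun f => (normalizedFactors p).count f
  let S : Finset F[X] := (normalizedFactors p).toFinset
  have hS : ∀ f, f ∈ S ↔ Irreducible f ∧ f.Monic ∧ f ∣ p := fun f => by
    rw [Multiset.mem_toFinset, mem_normalizedFactors_iff' hp0]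
    constructor
    · rintro ⟨h1, h2, h3⟩
      exact ⟨h1, h2 ▸ monic_normalize h1.ne_zero, h3⟩
    · rintro ⟨h1, h2, h3⟩
      exact ⟨h1, h2.normalize_eq_self, h3⟩
  have hprod : ∏ f ∈ S, f ^ m f = p := by
    rw [← Finset.prod_multiset_count, prod_normalizedFactors_eq hp0, hp.normalize_eq_self]
  have hm : ∀ f, Irreducible f → f.Monic → (m f : ℕ∞) = emultiplicity f p := fun f h1 h2 => by
    rw [emultiplicity_eq_count_normalizedFactors h1 hp0, h2.normalize_eq_self]
  have hm0 : ∀ f, f ∉ S → m f = 0 := fun f hf =>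
    Multiset.count_eq_zero.2 fun h => hf (Multiset.mem_toFinset.2 h)
  have hmpos : ∀ f ∈ S, 0 < m f := fun f hf => Multiset.count_pos.2 (Multiset.mem_toFinset.1 hf)
  have hcoeff : ∀ f ∈ S, f.coeff 0 ≠ 0 := fun f hf h0 => by
    obtain ⟨g, hg⟩ := ((hS f).1 hf).2.2
    rw [hg, mul_coeff_zero, h0, zero_mul] at hc0
    exact zero_ne_one hc0
  have hrS : ∀ f ∈ S, f.reciprocalPoly ∈ S := fun f hf => by
    have h := (hS f).1 hf
    refine (hS _).2 ⟨irreducible_reciprocalPoly h.1 (hcoeff f hf),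
      monic_reciprocalPoly (hcoeff f hf), ?_⟩
    have := reciprocalPoly_pow_dvd (n := 1) (hcoeff f hf) hr (by rw [pow_one]; exact h.2.2)
    rwa [pow_one] at this
  have hrr : ∀ f ∈ S, f.reciprocalPoly.reciprocalPoly = f := fun f hf =>
    reciprocalPoly_reciprocalPoly ((hS f).1 hf).2.1 (hcoeff f hf)
  have hmr : ∀ f ∈ S, m f.reciprocalPoly = m f := fun f hf => by
    have h := (hS f).1 hf
    have h' := (hS _).1 (hrS f hf)
    rw [← Nat.cast_inj (R := ℕ∞), hm f h.1 h.2.1, hm _ h'.1 h'.2.1,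
      emultiplicity_eq_emultiplicity_iff]
    intro n
    constructor
    · intro hd
      have := reciprocalPoly_pow_dvd (hcoeff _ (hrS f hf)) hr hd
      rwa [hrr f hf] at this
    · exact reciprocalPoly_pow_dvd (hcoeff f hf) hr
  have hmeven : ∀ c : F, c * c = 1 → Even (m (X - C c)) := fun c hc => by
    have hfin : FiniteMultiplicity (X - C c) p :=
      FiniteMultiplicity.of_not_isUnit (irreducible_X_sub_C c).not_isUnit hp0
    obtain ⟨g, hg, hng⟩ := hfin.exists_eq_pow_mul_and_not_dvd
    have h1 := hm _ (irreducible_X_sub_C c) (monic_X_sub_C c)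
    rw [hfin.emultiplicity_eq_multiplicity, Nat.cast_inj] at h1
    rw [h1]
    exact heven c hc _ g hg hng
  -- An arbitrary order selects one member of each pair {f, f*}: `SQ` keeps the smaller one.
  let lin : LinearOrder F[X] := linearOrderOfSTO WellOrderingRel
  let T : Finset F[X] := {X - 1, X + 1}
  let SP : Finset F[X] := {f ∈ S | f ∉ T ∧ f.reciprocalPoly = f}
  let SQ : Finset F[X] := {f ∈ S | f < f.reciprocalPoly}
  have hT : ∀ f ∈ T, f.reciprocalPoly = f := fun f hf => by
    simp only [T, Finset.mem_insert, Finset.mem_singleton] at hf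
    rcases hf with rfl | rfl
    · simpa using reciprocalPoly_X_sub_C (mul_one (1 : F))
    · have := reciprocalPoly_X_sub_C (c := (-1 : F)) (by ring)
      simpa using this
  have hSQ : ∀ f ∈ SQ, f ∈ S ∧ f < f.reciprocalPoly := fun f hf => Finset.mem_filter.1 hf
  have hSP : ∀ f ∈ SP, f ∈ S ∧ f ∉ T ∧ f.reciprocalPoly = f := fun f hf => Finset.mem_filter.1 hf
  have hsplit : p = (∏ f ∈ S with f ∈ T, f ^ m f) * (∏ f ∈ SP, f ^ m f) *
      ∏ f ∈ SQ, (f * f.reciprocalPoly) ^ m f := by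
    conv_lhs => rw [← hprod]
    rw [← Finset.prod_filter_mul_prod_filter_not S (· ∈ T), mul_assoc]
    congr 1
    rw [← Finset.prod_filter_mul_prod_filter_not (S.filter (· ∉ T))
      (fun f => f.reciprocalPoly = f), Finset.filter_filter]
    congr 1
    rw [Finset.filter_filter, ← Finset.prod_filter_mul_prod_filter_not _
      (fun f => f < f.reciprocalPoly), Finset.filter_filter, Finset.filter_filter]
    simp only [mul_pow, Finset.prod_mul_distrib]
    congr 1
    · refine Finset.prod_congr (Finset.filter_congr fun f _ => ?_) fun _ _ => rfl
      exact ⟨fun h => h.2, fun h => ⟨⟨fun hf => h.ne (hT f hf).symm, h.ne'⟩, h⟩⟩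
    · refine (Finset.prod_bij (fun f _ => f.reciprocalPoly) ?_ ?_ ?_ ?_).symm
      · intro f hf
        obtain ⟨h1, h2⟩ := hSQ f hf
        have h3 : f.reciprocalPoly.reciprocalPoly ≠ f.reciprocalPoly := by
          rw [hrr f h1]
          exact h2.ne
        refine Finset.mem_filter.2 ⟨hrS f h1, ⟨fun hf => h3 (hT _ hf), h3⟩, ?_⟩
        rw [hrr f h1]
        exact h2.not_gt
      · intro f hf g hg h
        rw [← hrr f (hSQ f hf).1, ← hrr g (hSQ g hg).1, h]
      · intro f hf
        obtain ⟨h1, ⟨h2, h3⟩, h4⟩ := Finset.mem_filter.1 hf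
        refine ⟨f.reciprocalPoly, Finset.mem_filter.2 ⟨hrS f h1, ?_⟩, hrr f h1⟩
        rw [hrr f h1]
        exact lt_of_le_of_ne (not_lt.1 h4) h3
      · intro f hf
        rw [hmr f (hSQ f hf).1]
  have hm1 : Even (m (X - 1)) := by simpa using hmeven 1 (mul_one 1)
  have hm2 : Even (m (X + 1)) := by simpa using hmeven (-1) (by ring)
  obtain ⟨a, ha⟩ := hm1
  obtain ⟨a', ha'⟩ := hm2
  have hT' : (∏ f ∈ S with f ∈ T, f ^ m f) = ∏ f ∈ T, f ^ m f := by
    refine Finset.prod_subset (fun f hf => (Finset.mem_filter.1 hf).2) fun f hf hf' => ?_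
    rw [hm0 f fun h => hf' (Finset.mem_filter.2 ⟨h, hf⟩), pow_zero]
  have hchar : (X - 1 : F[X]) = X + 1 ↔ ringChar F = 2 := by
    rw [← neg_one_eq_one_iff, sub_eq_add_neg, add_right_inj, ← C_1, ← C_neg, C_inj]
  let eP := (Finset.equivFin SP).symm
  let eQ := (Finset.equivFin SQ).symm
  refine ⟨{
    aPlus := a
    aMinus := if ringChar F = 2 then 0 else a'
    r := SP.card
    s := SQ.card
    P := fun i => eP i
    b := fun i => m (eP i)
    Q := fun j => eQ j
    c := fun j => m (eQ j)
    aMinus_eq_zero := fun h => if_pos h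
    P_monic := fun i => ((hS _).1 (hSP _ (eP i).2).1).2.1
    P_irreducible := fun i => ((hS _).1 (hSP _ (eP i).2).1).1
    P_reciprocal := fun i => (hSP _ (eP i).2).2.2
    P_ne := fun i => ?_
    P_injective := Subtype.val_injective.comp eP.injective
    b_pos := fun i => hmpos _ (hSP _ (eP i).2).1
    Q_monic := fun j => ((hS _).1 (hSQ _ (eQ j).2).1).2.1
    Q_irreducible := fun j => ((hS _).1 (hSQ _ (eQ j).2).1).1
    Q_coeff_zero := fun j => hcoeff _ (hSQ _ (eQ j).2).1
    Q_reciprocal_ne := fun j j' h => ?_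
    Q_injective := Subtype.val_injective.comp eQ.injective
    c_pos := fun j => hmpos _ (hSQ _ (eQ j).2).1
    eq_prod := ?_ }⟩
  · have := (hSP _ (eP i).2).2.1
    simpa [T] using this
  · have h1 := hSQ _ (eQ j).2
    have h2 := (hSQ _ (eQ j').2).2
    rw [← h, hrr _ h1.1] at h2
    exact lt_asymm h1.2 h2
  · rw [eP.prod_comp (fun f : SP => f.1 ^ m f), eQ.prod_comp
      (fun f : SQ => (f.1 * f.1.reciprocalPoly) ^ m f),
      Finset.prod_coe_sort SP (fun f => f ^ m f),
      Finset.prod_coe_sort SQ (fun f => (f * f.reciprocalPoly) ^ m f)]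
    conv_lhs => rw [hsplit, hT']
    congr 2
    by_cases h2 : ringChar F = 2
    · rw [if_pos h2, mul_zero, pow_zero, mul_one]
      -- In characteristic two X - 1 = X + 1, so its power must be counted once only, as the a₊
      -- part.
      have : T = {X - 1} := by
        simp only [T, hchar.2 h2, Finset.pair_eq_singleton]
      rw [this, Finset.prod_singleton, ha, two_mul]
    · rw [if_neg h2, Finset.prod_pair fun h => h2 (hchar.1 h), ha, ha', two_mul, two_mul]

end factorization

/-! ### Matrix models of blocks of the centralizer algebra -/

section models

variable {F E D D' : Type u} [Field F] [Ring E] [Algebra F E] [Ring D] [Algebra F D]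
  [Ring D'] [Algebra F D']

/-- `Φ` identifies `D` with `e C`, where `C` is the centralizer of `γ`. -/
structure IsModel (γ e : E) (Φ : D →ₗ[F] E) : Prop where
  map_one : Φ 1 = e
  map_mul : ∀ a b, Φ (a * b) = Φ a * Φ b
  injective : Function.Injective Φ
  comm : ∀ d, Commute γ (Φ d)
  surj : ∀ g, Commute γ g → e * g = g → ∃ d, Φ d = g

/-- The algebra `e C` with the antimultiplicative map `adj` is isomorphic to `D` with `τ`,
where `C` is the centralizer of `γ`. -/
def HasModel (γ : E) (adj : E →ₗ[F] E) (τ : AlgGrp.AntiHom F D) (e : E) : Prop :=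
  ∃ Φ : D →ₗ[F] E, IsModel γ e Φ ∧ ∀ d, adj (Φ d) = Φ (τ.toLinearMap d)

namespace IsModel

variable {γ e e' : E} {Φ : D →ₗ[F] E} {Φ' : D' →ₗ[F] E}

theorem idem (h : IsModel γ e Φ) : e * e = e := by
  rw [← h.map_one, ← h.map_mul, mul_one]

theorem commute (h : IsModel γ e Φ) : Commute γ e := by
  rw [← h.map_one]
  exact h.comm 1

theorem left_mul (h : IsModel γ e Φ) (d : D) : e * Φ d = Φ d := by
  rw [← h.map_one, ← h.map_mul, one_mul]

theorem mul_right (h : IsModel γ e Φ) (d : D) : Φ d * e = Φ d := by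
  rw [← h.map_one, ← h.map_mul, mul_one]

theorem mul_eq_zero (h : IsModel γ e Φ) (h' : IsModel γ e' Φ') (ho : e * e' = 0) (d : D)
    (d' : D') : Φ d * Φ' d' = 0 := by
  rw [← h.mul_right, ← h'.left_mul, mul_assoc, ← mul_assoc e, ho, zero_mul, mul_zero]

theorem left_mul_eq_zero (h' : IsModel γ e' Φ') (ho : e * e' = 0)
    (d' : D') : e * Φ' d' = 0 := by
  rw [← h'.left_mul, ← mul_assoc, ho, zero_mul]

theorem surj_mul (h : IsModel γ e Φ) {g : E} (hg : Commute γ g) : ∃ d, Φ d = e * g :=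
  h.surj _ (h.commute.mul_right hg) (by rw [← mul_assoc, h.idem])

end IsModel

/-- Orthogonal idempotents make all products between the two blocks vanish, so the sum of the two
embeddings is multiplicative. Multiplying by e or e' recovers each component, which gives
injectivity. -/
theorem HasModel.prod {γ : E} {adj : E →ₗ[F] E} {τ : AlgGrp.AntiHom F D}
    {τ' : AlgGrp.AntiHom F D'} {e e' : E} (h : HasModel γ adj τ e) (h' : HasModel γ adj τ' e')
    (ho : e * e' = 0) (ho' : e' * e = 0) : HasModel γ adj (τ.prod τ') (e + e') := by
  obtain ⟨Φ, h, ha⟩ := h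
  obtain ⟨Φ', h', ha'⟩ := h'
  refine ⟨Φ.coprod Φ', ⟨?_, ?_, ?_, ?_, ?_⟩, ?_⟩
  · rw [LinearMap.coprod_apply]
    exact congrArg₂ _ h.map_one h'.map_one
  · intro a b
    simp only [LinearMap.coprod_apply, Prod.fst_mul, Prod.snd_mul, h.map_mul, h'.map_mul,
      add_mul, mul_add, h.mul_eq_zero h' ho, h'.mul_eq_zero h ho', add_zero, zero_add]
  · rw [injective_iff_map_eq_zero]
    intro a hab
    rw [LinearMap.coprod_apply] at hab
    have h1 := congrArg (e * ·) hab
    have h2 := congrArg (e' * ·) hab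
    simp only [mul_add, h.left_mul, h'.left_mul, h'.left_mul_eq_zero ho, h.left_mul_eq_zero ho',
      add_zero, zero_add, mul_zero] at h1 h2
    exact Prod.ext (h.injective (h1.trans (map_zero Φ).symm))
      (h'.injective (h2.trans (map_zero Φ').symm))
  · intro d
    exact (h.comm _).add_right (h'.comm _)
  · intro g hg heg
    obtain ⟨d, hd⟩ := h.surj_mul hg
    obtain ⟨d', hd'⟩ := h'.surj_mul hg
    exact ⟨(d, d'), by rw [LinearMap.coprod_apply, hd, hd', ← add_mul, heg]⟩
  · intro d
    rw [LinearMap.coprod_apply, map_add, ha, ha']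
    rfl

theorem HasModel.pi {m : ℕ} {D : Fin m → Type u} [∀ i, Ring (D i)] [∀ i, Algebra F (D i)] {γ : E}
    {adj : E →ₗ[F] E} {τ : ∀ i, AlgGrp.AntiHom F (D i)} {e : Fin m → E}
    (h : ∀ i, HasModel γ adj (τ i) (e i)) (ho : Pairwise fun i j => e i * e j = 0) :
    HasModel γ adj (AlgGrp.AntiHom.pi τ) (∑ i, e i) := by
  classical
  choose Φ h ha using h
  have hΦ : ∀ d, LinearMap.lsum F D F Φ d = ∑ i, Φ i (d i) := fun d => by
    simp [LinearMap.lsum_apply]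
  have hoΦ : ∀ i (d : ∀ i, D i), e i * ∑ j, Φ j (d j) = Φ i (d i) := fun i d => by
    rw [Finset.mul_sum, Finset.sum_eq_single i]
    · exact (h i).left_mul _
    · exact fun j _ hj => (h j).left_mul_eq_zero (ho hj.symm) _
    · simp
  refine ⟨LinearMap.lsum F D F Φ, ⟨?_, ?_, ?_, ?_, ?_⟩, ?_⟩
  · rw [hΦ]
    exact Finset.sum_congr rfl fun i _ => (h i).map_one
  · intro a b
    rw [hΦ, hΦ, hΦ, Finset.sum_mul]
    refine Finset.sum_congr rfl fun i _ => ?_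
    rw [← (h i).mul_right (a i), mul_assoc, hoΦ]
    exact (h i).map_mul _ _
  · rw [injective_iff_map_eq_zero]
    intro a hab
    funext i
    apply (h i).injective
    rw [hΦ] at hab
    rw [← hoΦ, hab, mul_zero, Pi.zero_apply, map_zero]
  · intro d
    rw [hΦ]
    exact Commute.sum_right _ _ _ fun i _ => (h i).comm _
  · intro g hg heg
    choose d hd using fun i => (h i).surj_mul hg
    refine ⟨d, ?_⟩
    rw [hΦ, Finset.sum_congr rfl fun i _ => hd i, ← Finset.sum_mul, heg]
  · intro d
    rw [hΦ, hΦ, map_sum]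
    exact Finset.sum_congr rfl fun i _ => ha i _

/-- The part of the centralizer belonging to a pair of projections exchanged by `adj`. -/
theorem HasModel.of_swap {M : Type u} [Field M] [Algebra F M] {c : ℕ} {γ e : E}
    {adj : E →ₗ[F] E} {Φ : Matrix (Fin c) (Fin c) M →ₗ[F] E} (h : IsModel γ e Φ)
    (adj_mul : ∀ x y, adj (x * y) = adj y * adj x) (adj_adj : ∀ x, adj (adj x) = x)
    (hadj : ∀ g, Commute γ g → Commute γ (adj g)) (hcomm : ∀ g, Commute γ g → Commute e g)
    (ho : e * adj e = 0) (ho' : adj e * e = 0) :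
    HasModel γ adj (AlgGrp.swapAnti F M c) (e + adj e) := by
  -- The transpose turns the antimultiplicative adj ∘ Φ into a multiplicative model of the opposite
  -- block.
  let t : Matrix (Fin c) (Fin c) M →ₗ[F] Matrix (Fin c) (Fin c) M :=
    (Matrix.transposeLinearEquiv (Fin c) (Fin c) F M).toLinearMap
  have h' : IsModel γ (adj e) (adj ∘ₗ Φ ∘ₗ t) := by
    have ht : ∀ d, (adj ∘ₗ Φ ∘ₗ t) d = adj (Φ d.transpose) := fun d => rfl
    refine ⟨?_, ?_, ?_, ?_, ?_⟩
    · rw [ht, Matrix.transpose_one, h.map_one]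
    · intro a b
      rw [ht, ht, ht, Matrix.transpose_mul, h.map_mul, adj_mul]
    · intro a b hab
      rw [ht, ht] at hab
      have := congrArg adj hab
      rw [adj_adj, adj_adj] at this
      exact Matrix.transpose_injective (h.injective this)
    · intro d
      exact hadj _ (h.comm _)
    · intro g hg heg
      obtain ⟨d, hd⟩ := h.surj (adj g) (hadj g hg) (by
        rw [(hcomm _ (hadj g hg)).eq]
        nth_rewrite 2 [← heg]
        rw [adj_mul, adj_adj])
      exact ⟨d.transpose, by rw [ht, Matrix.transpose_transpose, hd, adj_adj]⟩
  have h1 : HasModel γ adj (AlgGrp.swapAnti F M c) (e + adj e) := by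
    refine ⟨Φ.coprod (adj ∘ₗ Φ ∘ₗ t), ⟨?_, ?_, ?_, ?_, ?_⟩, ?_⟩
    · rw [LinearMap.coprod_apply]
      exact congrArg₂ _ h.map_one h'.map_one
    · intro a b
      simp only [LinearMap.coprod_apply, Prod.fst_mul, Prod.snd_mul, h.map_mul, h'.map_mul,
        add_mul, mul_add, h.mul_eq_zero h' ho, h'.mul_eq_zero h ho', add_zero, zero_add]
    · rw [injective_iff_map_eq_zero]
      intro a hab
      rw [LinearMap.coprod_apply] at hab
      have h1 := congrArg (e * ·) hab
      have h2 := congrArg (adj e * ·) hab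
      simp only [mul_add, h.left_mul, h'.left_mul, h'.left_mul_eq_zero ho, h.left_mul_eq_zero ho',
        add_zero, zero_add, mul_zero] at h1 h2
      exact Prod.ext (h.injective (h1.trans (map_zero Φ).symm))
        (h'.injective (h2.trans (map_zero _).symm))
    · intro d
      exact (h.comm _).add_right (h'.comm _)
    · intro g hg heg
      obtain ⟨d, hd⟩ := h.surj_mul hg
      obtain ⟨d', hd'⟩ := h'.surj_mul hg
      exact ⟨(d, d'), by rw [LinearMap.coprod_apply, hd, hd', ← add_mul, heg]⟩
    · intro d
      rw [LinearMap.coprod_apply, map_add]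
      change adj (Φ d.1) + adj (adj (Φ d.2.transpose)) =
        Φ d.2.transpose + adj (Φ d.1.transpose.transpose)
      rw [adj_adj, Matrix.transpose_transpose, add_comm]
  exact h1

end models

/-! ### Primary parts as vector spaces over extension fields -/

section blocks

variable {F V : Type u} [Field F] [AddCommGroup V] [Module F V]

/-- The map `d ↦ ι d π` from matrices over `M` to endomorphisms of `V`, for a direct summand
`ι : W → V` with projection `π` and an `M`-basis of `W`. -/
noncomputable def blockMap {M W : Type u} [Field M] [Algebra F M] [AddCommGroup W] [Module F W]
    [Module M W] [IsScalarTower F M W] {m : Type} [Fintype m] [DecidableEq m]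
    (b : Module.Basis m M W) (ι : W →ₗ[F] V) (π : V →ₗ[F] W) :
    Matrix m m M →ₗ[F] Module.End F V where
  toFun d := ι ∘ₗ (Matrix.toLin b b d).restrictScalars F ∘ₗ π
  map_add' d d' := by
    ext v
    simp
  map_smul' c d := by
    ext v
    have : Matrix.toLin b b (c • d) = c • Matrix.toLin b b d :=
      (Matrix.toLin b b).toLinearMap.map_smul_of_tower c d
    change ι (Matrix.toLin b b (c • d) (π v)) = c • ι (Matrix.toLin b b d (π v))
    rw [this, LinearMap.smul_apply, map_smul]

theorem blockMap_apply {M W : Type u} [Field M] [Algebra F M] [AddCommGroup W] [Module F W]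
    [Module M W] [IsScalarTower F M W] {m : Type} [Fintype m] [DecidableEq m]
    (b : Module.Basis m M W) (ι : W →ₗ[F] V) (π : V →ₗ[F] W) (d : Matrix m m M) (v : V) :
    blockMap b ι π d v = ι (Matrix.toLin b b d (π v)) := rfl

/-- The part of the centralizer of `γ` belonging to an irreducible factor is a matrix algebra. -/
theorem isModel_blockMap {M W : Type u} [Field M] [Algebra F M] [AddCommGroup W] [Module F W]
    [Module M W] [IsScalarTower F M W] {m : Type} [Fintype m] [DecidableEq m]
    (b : Module.Basis m M W) {ι : W →ₗ[F] V} {π : V →ₗ[F] W} {γ e : Module.End F V}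
    (hπι : ∀ w, π (ι w) = w) (hιπ : ∀ v, ι (π v) = e v) (hγe : ∀ g, Commute γ g → Commute e g)
    {α : M} (hα : ∀ w, γ (ι w) = ι (α • w)) (hs : Function.Surjective (aeval α : F[X] →ₐ[F] M)) :
    IsModel γ e (blockMap b ι π) := by
  have hπγ : ∀ v, π (γ v) = α • π v := fun v => by
    have h1 : e (γ v) = γ (e v) := LinearMap.congr_fun (hγe γ (Commute.refl γ)).eq v
    rw [← hπι (α • π v), ← hα, hιπ, ← h1, ← hιπ, hπι]
  refine ⟨?_, ?_, ?_, ?_, ?_⟩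
  · ext v
    rw [blockMap_apply, Matrix.toLin_one, LinearMap.id_apply, hιπ]
  · intro d d'
    ext v
    rw [Module.End.mul_apply, blockMap_apply, blockMap_apply, blockMap_apply, hπι,
      Matrix.toLin_mul b b b]
    rfl
  · intro d d' h
    apply (Matrix.toLin b b).injective
    ext w
    have := congrArg π (LinearMap.congr_fun h (ι w))
    simpa only [blockMap_apply, hπι] using this
  · intro d
    apply LinearMap.ext
    intro v
    rw [Module.End.mul_apply, Module.End.mul_apply, blockMap_apply, blockMap_apply, hα, hπγ,
      LinearMap.map_smul (Matrix.toLin b b d)]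
  · intro g hg heg
    -- The compression of g to W commutes with α, hence with all of M = F[α]; so it is M-linear and
    -- has a matrix over M.
    let h : W →ₗ[F] W := π ∘ₗ g ∘ₗ ι
    have hh : ∀ w, h (α • w) = α • h w := fun w => by
      change π (g (ι (α • w))) = α • π (g (ι w))
      rw [← hα, ← hπγ, ← Module.End.mul_apply, ← hg.eq, Module.End.mul_apply]
    have hpow : ∀ (n : ℕ) w, h (α ^ n • w) = α ^ n • h w := fun n => by
      induction n with
      | zero => simp
      | succ n ih => intro w; rw [pow_succ, mul_smul, ih, hh, mul_smul]
    have hall : ∀ (p : F[X]) w, h (aeval α p • w) = aeval α p • h w := fun p w => by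
      induction p using Polynomial.induction_on' with
      | add p q hp hq => rw [map_add, add_smul, map_add, hp, hq, add_smul]
      | monomial n a =>
        rw [aeval_monomial, ← Algebra.smul_def, smul_assoc, map_smul, hpow, smul_assoc]
    let hM : W →ₗ[M] W :=
      { toFun := h
        map_add' := map_add h
        map_smul' := fun x w => by
          obtain ⟨p, rfl⟩ := hs x
          exact hall p w }
    refine ⟨LinearMap.toMatrix b b hM, ?_⟩
    ext v
    rw [blockMap_apply, Matrix.toLin_toMatrix]
    change ι (π (g (ι (π v)))) = g v
    rw [hιπ, hιπ, ← Module.End.mul_apply e, heg, ← Module.End.mul_apply, ← (hγe g hg).eq, heg]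

/-- An algebra homomorphism out of the field generated by a root of `f` exists for every element
annihilated by `f`. -/
theorem exists_algHom_of_aeval_eq_zero {F M A : Type*} [Field F] [Field M] [Algebra F M] [Ring A]
    [Algebra F A] {α : M} (hs : Function.Surjective (aeval α : F[X] →ₐ[F] M)) {a : A}
    (ha : aeval a (minpoly F α) = 0) : ∃ φ : M →ₐ[F] A, φ α = a := by
  have hker : ∀ p ∈ RingHom.ker (aeval α : F[X] →ₐ[F] M), aeval a p = 0 := by
    intro p hp
    obtain ⟨q, rfl⟩ := minpoly.dvd F α (RingHom.mem_ker.1 hp)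
    rw [map_mul, ha, zero_mul]
  let e := Ideal.quotientKerAlgEquivOfSurjective hs
  have he : e.symm α = Ideal.Quotient.mk _ X := by
    rw [AlgEquiv.symm_apply_eq]
    exact (aeval_X α).symm
  refine ⟨(Ideal.Quotient.liftₐ _ (aeval a) hker).comp e.symm.toAlgHom, ?_⟩
  change Ideal.Quotient.liftₐ _ (aeval a) hker (e.symm α) = a
  rw [he]
  exact aeval_X a

/-- The `f`-primary part of `V` is a vector space over `F[α]`, where `f(α) = 0`. -/
theorem exists_module_range {M : Type u} [Field M] [Algebra F M] [FiniteDimensional F M]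
    {γ e : Module.End F V} {f : F[X]} (h : IsProj γ f e) {α : M} (hα : minpoly F α = f)
    (hs : Function.Surjective (aeval α : F[X] →ₐ[F] M)) {m : ℕ}
    (hM : Module.finrank F M = f.natDegree)
    (hm : Module.finrank F (LinearMap.range e) = m * f.natDegree) :
    ∃ _ : Module M (LinearMap.range e), IsScalarTower F M (LinearMap.range e) ∧
      (∀ w : LinearMap.range e, γ w = ((α • w : LinearMap.range e) : V)) ∧
      Module.finrank M (LinearMap.range e) = m := by
  have he : ∀ x, x ∈ LinearMap.range e ↔ e x = x := fun x =>
    ⟨fun ⟨y, hy⟩ => by rw [← hy, ← Module.End.mul_apply, h.idem], fun hx => ⟨x, hx⟩⟩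
  have hU : ∀ x ∈ LinearMap.range e, γ x ∈ LinearMap.range e := fun x hx => by
    rw [he] at *
    rw [← Module.End.mul_apply, ← h.commute_self.eq, Module.End.mul_apply, hx]
  have hkill : aeval (γ.restrict hU) f = 0 := by
    ext x
    rw [aeval_restrict_apply, ← (he x).1 x.2, ← Module.End.mul_apply, h.kill]
    rfl
  -- Since f kills γ on the range of e, the field M acts there by sending α to γ.
  obtain ⟨φ, hφ⟩ := exists_algHom_of_aeval_eq_zero hs (hα.symm ▸ hkill)
  let inst : Module M (LinearMap.range e) := Module.compHom (LinearMap.range e)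
    (φ : M →+* Module.End F (LinearMap.range e))
  have hsmul : ∀ (c : M) (w : LinearMap.range e), c • w = φ c w := fun c w => rfl
  have ht : IsScalarTower F M (LinearMap.range e) := by
    refine ⟨fun a c w => ?_⟩
    rw [hsmul, hsmul, map_smul, LinearMap.smul_apply]
  refine ⟨inst, ht, fun w => ?_, ?_⟩
  · rw [hsmul, hφ]
    rfl
  · have h1 := Module.finrank_mul_finrank F M (LinearMap.range e)
    have h2 : 0 < Module.finrank F M := Module.finrank_pos
    rw [hm, hM, mul_comm] at h1
    exact Nat.eq_of_mul_eq_mul_right (hM ▸ h2) h1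

end blocks

/-! ### The three kinds of blocks -/

section adjoint

variable {F V : Type u} [Field F] [AddCommGroup V] [Module F V]

/-- A nondegenerate alternating form together with its adjoint map. -/
structure AlternatingAdjoint (B : V →ₗ[F] V →ₗ[F] F) (adj : Module.End F V →ₗ[F] Module.End F V) :
    Prop where
  alt : ∀ v, B v v = 0
  nondeg : ∀ v, (∀ w, B v w = 0) → v = 0
  adjoint : ∀ g v w, B (g v) w = B v (adj g w)

namespace AlternatingAdjoint

variable {B : V →ₗ[F] V →ₗ[F] F} {adj : Module.End F V →ₗ[F] Module.End F V}

theorem skew (h : AlternatingAdjoint B adj) (v w : V) : B v w = -B w v := by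
  have := h.alt (v + w)
  simp only [map_add, LinearMap.add_apply, h.alt, zero_add, add_zero] at this
  exact eq_neg_of_add_eq_zero_right this

/-- Nondegeneracy makes adjoints unique; the algebraic rules for adj below all follow from this. -/
theorem ext (h : AlternatingAdjoint B adj) {x y : Module.End F V}
    (H : ∀ v w, B v (x w) = B v (y w)) : x = y := by
  ext w
  rw [← sub_eq_zero]
  refine h.nondeg _ fun v => ?_
  rw [h.skew, map_sub, H, sub_self, neg_zero]

theorem adj_one (h : AlternatingAdjoint B adj) : adj 1 = 1 :=
  h.ext fun v w => by rw [← h.adjoint]; rfl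

theorem adj_mul (h : AlternatingAdjoint B adj) (x y : Module.End F V) :
    adj (x * y) = adj y * adj x :=
  h.ext fun v w => by
    rw [← h.adjoint, Module.End.mul_apply, Module.End.mul_apply, h.adjoint, h.adjoint]

theorem adj_adj (h : AlternatingAdjoint B adj) (x : Module.End F V) : adj (adj x) = x :=
  h.ext fun v w => by rw [← h.adjoint, h.skew, ← h.adjoint, ← h.skew]

/-- The form is nondegenerate on the range of a selfadjoint idempotent. -/
theorem nondeg_range (h : AlternatingAdjoint B adj) {e : Module.End F V} (he : e * e = e)
    (hadj : adj e = e) (w : LinearMap.range e) (hw : ∀ x : LinearMap.range e, B w x = 0) :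
    w = 0 := by
  apply Subtype.ext
  refine h.nondeg _ fun v => ?_
  have h1 : e w.1 = w.1 := by
    obtain ⟨y, hy⟩ := w.2
    rw [← hy, ← Module.End.mul_apply, he]
  rw [← h1, h.adjoint, hadj]
  exact hw ⟨e v, v, rfl⟩

/-- Adjoints of block maps are computed inside the block. -/
theorem adj_blockMap (h : AlternatingAdjoint B adj) {e : Module.End F V} (he : e * e = e)
    (hadj : adj e = e) {M : Type u} [Field M] [Algebra F M] [Module M (LinearMap.range e)]
    [IsScalarTower F M (LinearMap.range e)] {m : Type} [Fintype m] [DecidableEq m]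
    (b : Module.Basis m M (LinearMap.range e)) (τ : Matrix m m M → Matrix m m M)
    (hτ : ∀ g (x y : LinearMap.range e),
      B (Matrix.toLin b b g x : LinearMap.range e) y =
        B x (Matrix.toLin b b (τ g) y : LinearMap.range e)) (g : Matrix m m M) :
    adj (blockMap b (LinearMap.range e).subtype e.rangeRestrict g) =
      blockMap b (LinearMap.range e).subtype e.rangeRestrict (τ g) := by
  have h1 : ∀ w : LinearMap.range e, e w.1 = w.1 := fun w => by
    obtain ⟨y, hy⟩ := w.2
    rw [← hy, ← Module.End.mul_apply, he]
  refine h.ext fun v w => ?_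
  have hsa : ∀ x y, B (e x) y = B x (e y) := fun x y => by rw [h.adjoint, hadj]
  rw [← h.adjoint, blockMap_apply, blockMap_apply, Submodule.subtype_apply,
    Submodule.subtype_apply, ← h1, hsa, ← h1 (Matrix.toLin b b (τ g) _)]
  exact (hτ g (e.rangeRestrict v) (e.rangeRestrict w)).trans (hsa v _)

end AlternatingAdjoint

/-- The part of the centralizer belonging to an eigenvalue `±1`. -/
theorem hasModel_sympAnti [FiniteDimensional F V] {B : V →ₗ[F] V →ₗ[F] F}
    {adj : Module.End F V →ₗ[F] Module.End F V} (h : AlternatingAdjoint B adj)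
    {γ e : Module.End F V} (he : e * e = e) (hcomm : ∀ g, Commute γ g → Commute e g)
    (hadj : adj e = e) {c : F} (hc : ∀ v, γ (e v) = c • e v) :
    ∃ a, Module.finrank F (LinearMap.range e) = 2 * a ∧
      HasModel γ adj (AlgGrp.sympAnti F (Fin a)) e := by
  have h1 : ∀ w : LinearMap.range e, e w.1 = w.1 := fun w => by
    obtain ⟨y, hy⟩ := w.2
    rw [← hy, ← Module.End.mul_apply, he]
  obtain ⟨a, b, hb⟩ := exists_basis_adjoint_sympAnti
    (B.domRestrict₁₂ (LinearMap.range e) (LinearMap.range e)) (fun v => h.alt _)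
    (h.nondeg_range he hadj)
  -- Here γ acts as a scalar c, so the field of the block is F itself with α = c.
  refine ⟨a, ?_, blockMap b (LinearMap.range e).subtype e.rangeRestrict,
    isModel_blockMap b (fun w => Subtype.ext (h1 w)) (fun v => rfl) hcomm (α := c) (fun w => ?_)
      (fun x => ⟨C x, aeval_C _ _⟩),
    h.adj_blockMap he hadj b (fun g => (AlgGrp.sympAnti F (Fin a)).toLinearMap g) hb⟩
  · rw [Module.finrank_eq_card_basis b, Fintype.card_sum, Fintype.card_fin, two_mul]
  · change γ w.1 = c • w.1
    rw [← h1, hc]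

/-- The part of the centralizer belonging to a self-reciprocal irreducible polynomial. -/
theorem hasModel_conjAnti [Finite F] [FiniteDimensional F V] {B : V →ₗ[F] V →ₗ[F] F}
    {adj : Module.End F V →ₗ[F] Module.End F V} (h : AlternatingAdjoint B adj)
    {γ γ' e : Module.End F V} {f : F[X]} (he : IsProj γ f e)
    (hadj : adj e = e) (hγ : adj γ = γ') (hγγ' : γ' * γ = 1)
    (hf : f.Monic) (hi : Irreducible f) (hr : f.reciprocalPoly = f) (h1 : f ≠ X - 1)
    (h2 : f ≠ X + 1) {m : ℕ} (hm : Module.finrank F (LinearMap.range e) = m * f.natDegree)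
    {K L : Type u} [Field K] [Field L] [Algebra F K] [Algebra F L] [Algebra K L]
    [IsScalarTower F K L] (hL : Module.finrank F L = f.natDegree)
    (hKL : Module.finrank K L = 2) (σ : L ≃ₐ[K] L) (hσ : σ ≠ AlgEquiv.refl) :
    HasModel γ adj (AlgGrp.conjAnti F σ m) e := by
  have : Module.Finite F L := Module.finite_of_finrank_pos (hL ▸ hi.natDegree_pos)
  have : Finite L := Module.finite_of_finite F
  obtain ⟨hσσ, hnorm⟩ := exists_mul_conj_eq hKL σ hσ
  have hne : ∃ x, σ x ≠ x := by
    by_contra! H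
    exact hσ (AlgEquiv.ext H)
  obtain ⟨α, hα, hs⟩ := exists_root_surjective hf hi hL
  obtain ⟨ρ, hρα, hρρ, hρ1⟩ := exists_inversion hf hr h1 h2 hα hs
  -- L has only one nontrivial involution over F, so the given σ must be the one inverting α,
  -- whatever K and σ were chosen.
  have hρσ : ρ = σ.restrictScalars F := by
    refine involution_unique hρρ hρ1 (AlgEquiv.ext hσσ) fun H => hσ (AlgEquiv.ext fun x => ?_)
    exact DFunLike.congr_fun H x
  have hσα : σ α = α⁻¹ := by rw [← hρα, hρσ]; rfl
  have hα0 : α ≠ 0 := by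
    rintro rfl
    have h3 := coeff_zero_ne_of_reciprocalPoly_eq hf hr
    rw [minpoly.zero] at hα
    rw [← hα] at h3
    simp at h3
  obtain ⟨inst, ht, hαw, hfr⟩ := exists_module_range he hα hs hL hm
  have hee : ∀ w : LinearMap.range e, e w.1 = w.1 := fun w => by
    obtain ⟨y, hy⟩ := w.2
    rw [← hy, ← Module.End.mul_apply, he.idem]
  let BW := B.domRestrict₁₂ (LinearMap.range e) (LinearMap.range e)
  have hBα : ∀ v w : LinearMap.range e, BW (α • v) w = BW v (α⁻¹ • w) := by
    intro v w
    change B (α • v : LinearMap.range e) w = B v (α⁻¹ • w : LinearMap.range e)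
    have h3 : w.1 = γ (α⁻¹ • w : LinearMap.range e) := by
      rw [hαw, smul_smul, mul_inv_cancel₀ hα0, one_smul]
    rw [← hαw, h.adjoint, hγ]
    conv_lhs => rw [h3, ← Module.End.mul_apply, hγγ']
    rfl
  have hBpow : ∀ (n : ℕ) (v w : LinearMap.range e), BW (α ^ n • v) w = BW v (α⁻¹ ^ n • w) := by
    intro n
    induction n with
    | zero => simp
    | succ n ih => intro v w; rw [pow_succ, mul_smul, ih, hBα, smul_smul, pow_succ']
  -- From adj(γ) = γ⁻¹ and γ = α on the block, B(α v, w) = B(v, α⁻¹ w); since L = F[α], this extends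
  -- to all scalars with σ as adjoint.
  have hB : ∀ (c : L) (v w : LinearMap.range e), BW (c • v) w = BW v (σ c • w) := by
    intro c v w
    obtain ⟨p, rfl⟩ := hs c
    induction p using Polynomial.induction_on' with
    | add p q hp hq =>
      rw [map_add, map_add, add_smul, add_smul, map_add, map_add, LinearMap.add_apply, hp, hq]
    | monomial n a =>
      have h4 : σ (a • α ^ n) = a • α⁻¹ ^ n := by
        rw [← hσα, ← map_pow]
        exact map_smul (σ.restrictScalars F) a (α ^ n)
      rw [aeval_monomial, ← Algebra.smul_def, h4, smul_assoc, smul_assoc,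
        LinearMap.map_smul BW, LinearMap.smul_apply, hBpow, LinearMap.map_smul (BW v)]
  have : FiniteDimensional L (LinearMap.range e) := Module.Finite.right F L _
  obtain ⟨b, hb⟩ := exists_basis_adjoint_conj ((σ.restrictScalars F : L ≃ₐ[F] L) : L →ₐ[F] L)
    hσσ hne hnorm hfr BW (fun v => h.alt _) (h.nondeg_range he.idem hadj) hB
  exact ⟨blockMap b (LinearMap.range e).subtype e.rangeRestrict,
    isModel_blockMap b (fun w => Subtype.ext (hee w)) (fun v => rfl) he.comm hαw hs,
    h.adj_blockMap he.idem hadj b (fun g => (AlgGrp.conjAnti F σ m).toLinearMap g) hb⟩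

/-- The part of the centralizer belonging to a pair of distinct reciprocal irreducible
polynomials. -/
theorem hasModel_swapAnti [Finite F] [FiniteDimensional F V] {B : V →ₗ[F] V →ₗ[F] F}
    {adj : Module.End F V →ₗ[F] Module.End F V} (h : AlternatingAdjoint B adj)
    {γ e : Module.End F V} {f : F[X]} (he : IsProj γ f e)
    (hadj : ∀ g, Commute γ g → Commute γ (adj g)) (ho : e * adj e = 0) (ho' : adj e * e = 0)
    (hf : f.Monic) (hi : Irreducible f) {m : ℕ}
    (hm : Module.finrank F (LinearMap.range e) = m * f.natDegree)
    {M : Type u} [Field M] [Algebra F M] (hM : Module.finrank F M = f.natDegree) :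
    HasModel γ adj (AlgGrp.swapAnti F M m) (e + adj e) := by
  have : Module.Finite F M := Module.finite_of_finrank_pos (hM ▸ hi.natDegree_pos)
  obtain ⟨α, hα, hs⟩ := exists_root_surjective hf hi hM
  obtain ⟨inst, ht, hαw, hfr⟩ := exists_module_range he hα hs hM hm
  have hee : ∀ w : LinearMap.range e, e w.1 = w.1 := fun w => by
    obtain ⟨y, hy⟩ := w.2
    rw [← hy, ← Module.End.mul_apply, he.idem]
  have : FiniteDimensional M (LinearMap.range e) := Module.Finite.right F M _
  exact HasModel.of_swap (isModel_blockMap (Module.finBasisOfFinrankEq M _ hfr)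
    (ι := (LinearMap.range e).subtype) (π := e.rangeRestrict)
    (fun w => Subtype.ext (hee w)) (fun v => rfl) he.comm hαw hs) h.adj_mul h.adj_adj hadj he.comm
    ho ho'

end adjoint

/-! ### Primary decomposition of a semisimple endomorphism -/

section decomposition

variable {F : Type u} [Field F]

theorem isCoprime_of_monic_irreducible_ne {f g : F[X]} (hf : Irreducible f) (hg : Irreducible g)
    (hf' : f.Monic) (hg' : g.Monic) (h : f ≠ g) : IsCoprime f g := by
  rw [hf.coprime_iff_not_dvd]
  exact fun hd => h (eq_of_monic_of_associated hf' hg' (hf.associated_of_dvd hg hd))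

/-- A semisimple endomorphism decomposes the space into primary parts, whose dimensions are read
off from the characteristic polynomial. -/
theorem exists_projections {V I : Type*} [AddCommGroup V] [Module F V] [FiniteDimensional F V]
    [Fintype I] {γ : Module.End F V} (hγ : γ.IsSemisimple) {f : I → F[X]} {m : I → ℕ}
    (hchar : γ.charpoly = ∏ i, f i ^ m i) (hcop : Pairwise fun i j => IsCoprime (f i) (f j))
    (hf : ∀ i, Irreducible (f i) ∨ f i = 1) :
    ∃ e : I → Module.End F V, (∀ i, IsProj γ (f i) (e i)) ∧
      (∀ i, Module.finrank F (LinearMap.range (e i)) = m i * (f i).natDegree) ∧ ∑ i, e i = 1 := by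
  classical
  -- The minimal polynomial is squarefree and divides the characteristic polynomial, hence a power
  -- of ∏ f i; so it divides ∏ f i. The added 1 keeps the exponent nonzero.
  have hdvd : minpoly F γ ∣ ∏ i, f i := by
    rw [← hγ.minpoly_squarefree.dvd_pow_iff_dvd (n := ∑ i, m i + 1) (Nat.succ_ne_zero _)]
    refine (LinearMap.minpoly_dvd_charpoly γ).trans ?_
    rw [hchar, ← Finset.prod_pow]
    refine Finset.prod_dvd_prod_of_dvd _ _ fun i _ => pow_dvd_pow _ ?_
    exact (Finset.single_le_sum (f := m) (fun _ _ => Nat.zero_le _) (Finset.mem_univ i)).trans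
      (Nat.le_succ _)
  have hkill : aeval γ (∏ i, f i) = 0 := by
    obtain ⟨g, hg⟩ := hdvd
    rw [hg, map_mul, minpoly.aeval, zero_mul]
  have hex : ∀ i, ∃ e, IsProj γ (f i) e := fun i => by
    refine exists_isProj (g := ∏ j ∈ Finset.univ.erase i, f j) ?_ ?_
    · rw [Finset.mul_prod_erase _ _ (Finset.mem_univ i), hkill]
    · exact IsCoprime.prod_right fun j hj => hcop (Finset.ne_of_mem_erase hj).symm
  choose e he using hex
  refine ⟨e, he, fun i => ?_, IsProj.sum_eq_one he hcop hkill⟩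
  rcases hf i with h | h
  · refine (he i).finrank_range h (g := ∏ j ∈ Finset.univ.erase i, f j ^ m j) ?_ ?_
    · rw [Finset.mul_prod_erase _ (fun j => f j ^ m j) (Finset.mem_univ i), hchar]
    · rw [← h.coprime_iff_not_dvd]
      exact IsCoprime.prod_right fun j hj => (hcop (Finset.ne_of_mem_erase hj).symm).pow_right
  · have h0 : e i = 0 := IsProj.eq_zero_of_one (h ▸ he i)
    rw [h0, h, natDegree_one, mul_zero, LinearMap.range_zero, finrank_bot]

end decomposition

/-! ### The factors of a symplectic factorization -/

namespace SymplecticFactorization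

variable {F : Type u} [Field F] {p : F[X]} (D : SymplecticFactorization p)

/-- The irreducible factors occurring in a symplectic factorization (with `1` in place of `X + 1`
in characteristic two). -/
noncomputable def factor :
    (Unit ⊕ Unit) ⊕ (Fin D.r ⊕ (Fin D.s ⊕ Fin D.s)) → F[X] :=
  Sum.elim (Sum.elim (fun _ => X - 1) fun _ => if ringChar F = 2 then 1 else X + 1)
    (Sum.elim D.P (Sum.elim D.Q fun j => (D.Q j).reciprocalPoly))

/-- The multiplicities of the factors of a symplectic factorization. -/
def mult : (Unit ⊕ Unit) ⊕ (Fin D.r ⊕ (Fin D.s ⊕ Fin D.s)) → ℕ :=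
  Sum.elim (Sum.elim (fun _ => 2 * D.aPlus) fun _ => 2 * D.aMinus) (Sum.elim D.b (Sum.elim D.c D.c))

theorem prod_factor : p = ∏ i, D.factor i ^ D.mult i := by
  simp only [Fintype.prod_sum_type, factor, mult, Sum.elim_inl, Sum.elim_inr,
    Finset.univ_unique, Finset.prod_singleton]
  have h : (if ringChar F = 2 then 1 else X + 1 : F[X]) ^ (2 * D.aMinus) =
      (X + 1) ^ (2 * D.aMinus) := by
    split_ifs with h
    · rw [D.aMinus_eq_zero h, mul_zero, pow_zero, pow_zero]
    · rfl
  rw [h, ← Finset.prod_mul_distrib, ← mul_assoc]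
  simp only [← mul_pow]
  exact D.eq_prod

theorem X_sub_one_reciprocalPoly : (X - 1 : F[X]).reciprocalPoly = X - 1 := by
  simpa using reciprocalPoly_X_sub_C (mul_one (1 : F))

theorem X_add_one_reciprocalPoly : (X + 1 : F[X]).reciprocalPoly = X + 1 := by
  simpa using reciprocalPoly_X_sub_C (c := (-1 : F)) (by ring)

theorem one_reciprocalPoly : (1 : F[X]).reciprocalPoly = 1 := by
  have : (1 : F[X]).reverse = 1 := by simpa using reverse_C (1 : F)
  rw [reciprocalPoly, this]
  simp

theorem irreducible_X_sub_one : Irreducible (X - 1 : F[X]) := by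
  simpa using irreducible_X_sub_C (1 : F)

theorem irreducible_X_add_one : Irreducible (X + 1 : F[X]) := by
  simpa using irreducible_X_sub_C (-1 : F)

theorem factor_irreducible_or (i) :
    (Irreducible (D.factor i) ∧ (D.factor i).Monic) ∨ D.factor i = 1 := by
  rcases i with ((i | i) | (i | (j | j)))
  · have : D.factor (Sum.inl (Sum.inl i)) = X - 1 := rfl
    rw [this]
    exact Or.inl ⟨irreducible_X_sub_one, by simpa using monic_X_sub_C (1 : F)⟩
  · by_cases h : ringChar F = 2
    · exact Or.inr (if_pos h)
    · refine Or.inl ?_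
      have : D.factor (Sum.inl (Sum.inr i)) = X + 1 := if_neg h
      rw [this]
      exact ⟨irreducible_X_add_one, by simpa using monic_X_sub_C (-1 : F)⟩
  · exact Or.inl ⟨D.P_irreducible i, D.P_monic i⟩
  · exact Or.inl ⟨D.Q_irreducible j, D.Q_monic j⟩
  · exact Or.inl ⟨irreducible_reciprocalPoly (D.Q_irreducible j) (D.Q_coeff_zero j),
      monic_reciprocalPoly (D.Q_coeff_zero j)⟩

/-- The operation f ↦ f* fixes X ∓ 1, 1 and every P i but no Q j; being an involution on the Q j, it
keeps the Q j and their reciprocals away from the fixed factors. -/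
theorem factor_injective : Function.Injective D.factor := by
  have hrr : ∀ j, (D.Q j).reciprocalPoly.reciprocalPoly = D.Q j := fun j =>
    reciprocalPoly_reciprocalPoly (D.Q_monic j) (D.Q_coeff_zero j)
  have hQ : ∀ {g : F[X]}, g.reciprocalPoly = g → ∀ j, D.Q j ≠ g := by
    rintro _ hg j rfl
    exact D.Q_reciprocal_ne j j hg
  have hQ' : ∀ {g : F[X]}, g.reciprocalPoly = g → ∀ j, (D.Q j).reciprocalPoly ≠ g := by
    intro g hg j h
    refine hQ hg j ?_
    rw [← hrr, h, hg]
  have hm : (if ringChar F = 2 then 1 else X + 1 : F[X]).reciprocalPoly =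
      if ringChar F = 2 then 1 else X + 1 := by
    split_ifs
    · exact one_reciprocalPoly
    · exact X_add_one_reciprocalPoly
  have h1 : (X - 1 : F[X]) ≠ if ringChar F = 2 then 1 else X + 1 := by
    split_ifs with h
    · intro h'
      exact irreducible_X_sub_one.not_isUnit (h' ▸ isUnit_one)
    · rw [← neg_one_eq_one_iff] at h
      intro h'
      rw [sub_eq_add_neg, add_right_inj, ← C_1, ← C_neg, C_inj] at h'
      exact h h'
  have hP : ∀ i, D.P i ≠ if ringChar F = 2 then 1 else X + 1 := by
    intro i
    split_ifs
    · intro h'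
      exact (D.P_irreducible i).not_isUnit (h' ▸ isUnit_one)
    · exact (D.P_ne i).2
  have hX := X_sub_one_reciprocalPoly (F := F)
  rintro ((⟨⟩ | ⟨⟩) | (i | (j | j))) ((⟨⟩ | ⟨⟩) | (i' | (j' | j'))) h
  · rfl
  · exact (h1 h).elim
  · exact ((D.P_ne i').1 h.symm).elim
  · exact (hQ hX j' h.symm).elim
  · exact (hQ' hX j' h.symm).elim
  · exact (h1 h.symm).elim
  · rfl
  · exact (hP i' h.symm).elim
  · exact (hQ hm j' h.symm).elim
  · exact (hQ' hm j' h.symm).elim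
  · exact ((D.P_ne i).1 h).elim
  · exact (hP i h).elim
  · rw [D.P_injective h]
  · exact (hQ (D.P_reciprocal i) j' h.symm).elim
  · exact (hQ' (D.P_reciprocal i) j' h.symm).elim
  · exact (hQ hX j h).elim
  · exact (hQ hm j h).elim
  · exact (hQ (D.P_reciprocal i') j h).elim
  · rw [D.Q_injective h]
  · exact (D.Q_reciprocal_ne j' j h.symm).elim
  · exact (hQ' hX j h).elim
  · exact (hQ' hm j h).elim
  · exact (hQ' (D.P_reciprocal i') j h).elim
  · exact (D.Q_reciprocal_ne j j' h).elim
  · have h2 : (D.Q j).reciprocalPoly = (D.Q j').reciprocalPoly := h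
    have h3 : D.Q j = D.Q j' := by rw [← hrr j, h2, hrr]
    rw [D.Q_injective h3]

theorem factor_coprime : Pairwise fun i j => IsCoprime (D.factor i) (D.factor j) := by
  intro i j hij
  rcases D.factor_irreducible_or i with ⟨h1, h2⟩ | h
  · rcases D.factor_irreducible_or j with ⟨h3, h4⟩ | h
    · exact isCoprime_of_monic_irreducible_ne h1 h3 h2 h4 (D.factor_injective.ne hij)
    · simp only [h, isCoprime_one_right]
  · simp only [h, isCoprime_one_left]

end SymplecticFactorization

/-! ### The standard symplectic space and assembly of the blocks -/

section standard

variable {F : Type u} [Field F]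

/-- The adjoint with respect to the standard symplectic form. -/
noncomputable def stdAdj (F : Type u) [Field F] (n : ℕ) :
    Module.End F (Fin n ⊕ Fin n → F) →ₗ[F] Module.End F (Fin n ⊕ Fin n → F) :=
  Matrix.toLin'.toLinearMap ∘ₗ (AlgGrp.sympAnti F (Fin n)).toLinearMap ∘ₗ
    LinearMap.toMatrix'.toLinearMap

theorem stdAdj_toLin' {n : ℕ} (g : Matrix (Fin n ⊕ Fin n) (Fin n ⊕ Fin n) F) :
    stdAdj F n (Matrix.toLin' g) =
      Matrix.toLin' ((AlgGrp.sympAnti F (Fin n)).toLinearMap g) := by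
  simp [stdAdj]

theorem alternatingAdjoint_std (n : ℕ) :
    AlternatingAdjoint (Matrix.toLinearMap₂' F (Matrix.J (Fin n) F)) (stdAdj F n) := by
  refine ⟨fun v => ?_, fun v hv => ?_, fun g v w => ?_⟩
  · rw [Matrix.toLinearMap₂'_apply', Matrix.J, ← Sum.elim_comp_inl_inr v,
      Matrix.fromBlocks_mulVec, sumElim_dotProduct_sumElim]
    simp [dotProduct_comm, Matrix.neg_mulVec]
  · have h1 : (Matrix.J (Fin n) F).transpose.mulVec v = 0 := by
      refine dotProduct_eq_zero _ fun w => ?_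
      rw [← hv w, Matrix.toLinearMap₂'_apply', Matrix.mulVec_transpose, ← Matrix.dotProduct_mulVec]
    have h2 := congrArg (Matrix.J (Fin n) F).mulVec h1
    rw [Matrix.mulVec_mulVec, Matrix.J_transpose, Matrix.mul_neg, Matrix.J_squared, neg_neg,
      Matrix.one_mulVec, Matrix.mulVec_zero] at h2
    exact h2
  · obtain ⟨g, rfl⟩ := Matrix.toLin'.surjective g
    rw [stdAdj_toLin', Matrix.toLinearMap₂'_apply', Matrix.toLinearMap₂'_apply',
      AlgGrp.sympAnti_apply, Matrix.toLin'_apply, Matrix.toLin'_apply, Matrix.mulVec_mulVec,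
      Matrix.mul_neg, ← Matrix.mul_assoc, ← Matrix.mul_assoc, Matrix.J_squared]
    simp only [Matrix.neg_mul, Matrix.one_mul, neg_neg]
    rw [← Matrix.mulVec_mulVec, Matrix.dotProduct_mulVec _ g.transpose, Matrix.vecMul_transpose]

theorem nonempty_iso_of_hasModel {n : ℕ} (γ : Matrix.symplecticGroup (Fin n) F) {D : Type u}
    [Ring D] [Algebra F D] {τ : AlgGrp.AntiHom F D}
    (h : HasModel (Matrix.toLin' γ.1) (stdAdj F n) τ 1) :
    Nonempty (AlgGrp.Iso τ ≅ AlgGrp.spCentralizer γ) := by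
  obtain ⟨Φ, h, ha⟩ := h
  let Ψ : D →ₐ[F] Matrix (Fin n ⊕ Fin n) (Fin n ⊕ Fin n) F :=
    (LinearMap.toMatrixAlgEquiv' (R := F)).toAlgHom.comp (AlgHom.ofLinearMap Φ h.map_one h.map_mul)
  have hΨ : ∀ d, Ψ d = LinearMap.toMatrix' (Φ d) := fun d => rfl
  refine AlgGrp.spCentralizer_iso γ Ψ ?_ ?_ ?_
  · intro a b hab
    exact h.injective (LinearMap.toMatrix'.injective hab)
  · intro g
    constructor
    · rintro ⟨d, rfl⟩
      have h1 := congrArg LinearMap.toMatrix' (h.comm d).eq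
      rw [Module.End.mul_eq_comp, Module.End.mul_eq_comp, LinearMap.toMatrix'_comp,
        LinearMap.toMatrix'_comp, LinearMap.toMatrix'_toLin'] at h1
      exact h1
    · intro hg
      have hg' : Commute (Matrix.toLin' γ.1) (Matrix.toLin' g) := by
        change _ * _ = _ * _
        rw [Module.End.mul_eq_comp, Module.End.mul_eq_comp, ← Matrix.toLin'_mul,
          ← Matrix.toLin'_mul, hg.eq]
      obtain ⟨d, hd⟩ := h.surj _ hg' (one_mul _)
      exact ⟨d, by rw [hΨ, hd, LinearMap.toMatrix'_toLin']⟩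
  · intro d
    rw [hΨ, hΨ, ← ha]
    simp [stdAdj]

theorem stdAdj_mul_self {n : ℕ} (γ : Matrix.symplecticGroup (Fin n) F) :
    stdAdj F n (Matrix.toLin' γ.1) * Matrix.toLin' γ.1 = 1 ∧
      Matrix.toLin' γ.1 * stdAdj F n (Matrix.toLin' γ.1) = 1 := by
  have h := AlgGrp.mem_symplecticGroup_iff_sympAnti.1 γ.2
  rw [stdAdj_toLin', Module.End.mul_eq_comp, Module.End.mul_eq_comp, ← Matrix.toLin'_mul,
    ← Matrix.toLin'_mul, mul_eq_one_comm.1 h, h, Matrix.toLin'_one]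
  exact ⟨rfl, rfl⟩

theorem commute_stdAdj {n : ℕ} (γ : Matrix.symplecticGroup (Fin n) F)
    {g : Module.End F (Fin n ⊕ Fin n → F)} (hg : Commute (Matrix.toLin' γ.1) g) :
    Commute (Matrix.toLin' γ.1) (stdAdj F n g) := by
  obtain ⟨h1, h2⟩ := stdAdj_mul_self γ
  set a := stdAdj F n (Matrix.toLin' γ.1)
  set c := Matrix.toLin' γ.1
  set x := stdAdj F n g
  have h3 : x * a = a * x := by
    have := congrArg (stdAdj F n) hg.eq
    rwa [(alternatingAdjoint_std n).adj_mul, (alternatingAdjoint_std n).adj_mul] at this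
  calc c * x = c * x * (a * c) := by rw [h1, mul_one]
    _ = c * (x * a) * c := by simp only [mul_assoc]
    _ = c * a * x * c := by rw [h3]; simp only [mul_assoc]
    _ = x * c := by rw [h2, one_mul]

/-- Since adj(γ) = γ⁻¹, adjoints of projections belong to reversed polynomials; normalizing to the
reciprocal polynomial is a nonzero constant and changes nothing. -/
theorem isProj_stdAdj {n : ℕ} (γ : Matrix.symplecticGroup (Fin n) F) {f : F[X]}
    {e : Module.End F (Fin n ⊕ Fin n → F)} (h : IsProj (Matrix.toLin' γ.1) f e)
    (h0 : f.coeff 0 ≠ 0) : IsProj (Matrix.toLin' γ.1) f.reciprocalPoly (stdAdj F n e) :=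
  (h.adj (stdAdj F n) (alternatingAdjoint_std n).adj_one (alternatingAdjoint_std n).adj_mul
    (alternatingAdjoint_std n).adj_adj rfl (stdAdj_mul_self γ).2 (stdAdj_mul_self γ).1).C_mul
    (inv_ne_zero h0)

/-- The eigenvalues `±1` of a semisimple symplectic matrix have even multiplicity. -/
theorem even_multiplicity {n : ℕ} (γ : Matrix.symplecticGroup (Fin n) F)
    (hγ : Module.End.IsSemisimple (Matrix.toLin' γ.1)) (c : F) (hc : c * c = 1) (k : ℕ) (g : F[X])
    (hg : γ.1.charpoly = (X - C c) ^ k * g) (hng : ¬ (X - C c) ∣ g) : Even k := by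
  have hi := irreducible_X_sub_C c
  have hc0 : (X - C c : F[X]).coeff 0 ≠ 0 := by
    simpa using left_ne_zero_of_mul_eq_one hc
  have hmin : minpoly F (Matrix.toLin' γ.1) ≠ 0 :=
    minpoly.ne_zero (Algebra.IsIntegral.isIntegral _)
  obtain ⟨q, hq, hnq⟩ := (FiniteMultiplicity.of_not_isUnit hi.not_isUnit
    hmin).exists_eq_pow_mul_and_not_dvd
  -- By semisimplicity X - c occurs at most once in the minimal polynomial, so γ is the scalar c on
  -- the primary part. As c = c⁻¹, its projection is selfadjoint and the part is a symplectic space.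
  have hle : multiplicity (X - C c) (minpoly F (Matrix.toLin' γ.1)) ≤ 1 := by
    by_contra! hlt
    refine hi.not_isUnit (hγ.minpoly_squarefree _ ?_)
    rw [hq, ← pow_two]
    exact (pow_dvd_pow _ hlt).trans (dvd_mul_right _ _)
  have hkill : aeval (Matrix.toLin' γ.1) ((X - C c) * q) = 0 := by
    have : minpoly F (Matrix.toLin' γ.1) ∣ (X - C c) * q := by
      rw [hq]
      refine mul_dvd_mul_right ?_ q
      conv_rhs => rw [← pow_one (X - C c)]
      exact pow_dvd_pow _ hle
    obtain ⟨t, ht⟩ := this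
    rw [ht, map_mul, minpoly.aeval, zero_mul]
  obtain ⟨e, he⟩ := exists_isProj hkill (hi.coprime_iff_not_dvd.2 hnq)
  have hadj : stdAdj F n e = e := by
    have := isProj_stdAdj γ he hc0
    rw [reciprocalPoly_X_sub_C hc] at this
    exact this.unique he
  obtain ⟨a, ha, -⟩ := hasModel_sympAnti (alternatingAdjoint_std n) he.idem he.comm hadj (c := c)
    (fun v => by
      have := LinearMap.congr_fun he.kill v
      simpa [sub_eq_zero, Algebra.algebraMap_eq_smul_one] using this)
  have hfr := he.finrank_range hi (by rw [Matrix.charpoly_toLin', hg]) hng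
  rw [natDegree_X_sub_C, mul_one, ha] at hfr
  exact ⟨a, by rw [← hfr, two_mul]⟩

/-- The projections add up to 1, so the product of the block models is a model of the whole
centralizer algebra; its isometry group is the product of those of the blocks. -/
theorem nonempty_iso_prod [Finite F] {n : ℕ} (γ : Matrix.symplecticGroup (Fin n) F)
    (hγ : Module.End.IsSemisimple (Matrix.toLin' γ.1)) (D : SymplecticFactorization γ.1.charpoly)
    (K L : Fin D.r → Type u) (M : Fin D.s → Type u)
    [∀ i, Field (K i)] [∀ i, Algebra F (K i)] [∀ i, Field (L i)] [∀ i, Algebra (K i) (L i)]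
    [∀ i, Algebra F (L i)] [∀ i, IsScalarTower F (K i) (L i)]
    [∀ j, Field (M j)] [∀ j, Algebra F (M j)] (σ : ∀ i, L i ≃ₐ[K i] L i)
    (hL : ∀ i, Module.finrank F (L i) = (D.P i).natDegree)
    (hKL : ∀ i, Module.finrank (K i) (L i) = 2) (hσ : ∀ i, σ i ≠ AlgEquiv.refl)
    (hM : ∀ j, Module.finrank F (M j) = (D.Q j).natDegree) :
    Nonempty (AlgGrp.spCentralizer γ ≅ AlgGrp.prod (AlgGrp.prod (AlgGrp.prod
      (AlgGrp.Sp F D.aPlus) (AlgGrp.Sp F D.aMinus))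
      (AlgGrp.pi fun i => AlgGrp.Res F (AlgGrp.U (σ i) (D.b i))))
      (AlgGrp.pi fun j => AlgGrp.Res F (AlgGrp.GLn (M j) (D.c j)))) := by
  have hB := alternatingAdjoint_std (F := F) n
  obtain ⟨e, he, hfr, hsum⟩ := exists_projections hγ
    (by rw [Matrix.charpoly_toLin']; exact D.prod_factor) D.factor_coprime
    fun i => (D.factor_irreducible_or i).imp_left And.left
  have ho : ∀ {i j}, i ≠ j → e i * e j = 0 := fun {i j} hij =>
    (he i).orth (he j) (D.factor_coprime hij)
  have hadj : ∀ i j, (D.factor i).coeff 0 ≠ 0 → (D.factor i).reciprocalPoly = D.factor j →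
      stdAdj F n (e i) = e j := fun i j h0 hij =>
    (hij ▸ isProj_stdAdj γ (he i) h0).unique (he j)
  have hplus : HasModel (Matrix.toLin' γ.1) (stdAdj F n) (AlgGrp.sympAnti F (Fin D.aPlus))
      (e (Sum.inl (Sum.inl ()))) := by
    have hf : D.factor (Sum.inl (Sum.inl ())) = X - 1 := rfl
    obtain ⟨a, ha, hmod⟩ := hasModel_sympAnti hB (he _).idem (he _).comm
      (hadj (Sum.inl (Sum.inl ())) _ (by rw [hf]; simp)
        (by rw [hf]; exact SymplecticFactorization.X_sub_one_reciprocalPoly)) (c := 1)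
      (fun v => by
        have := LinearMap.congr_fun (he (Sum.inl (Sum.inl ()))).kill v
        rw [hf] at this
        simpa [sub_eq_zero] using this)
    rw [hfr, hf] at ha
    have hdeg : (X - 1 : F[X]).natDegree = 1 := by simpa using natDegree_X_sub_C (1 : F)
    rw [hdeg, mul_one] at ha
    obtain rfl : D.aPlus = a := Nat.eq_of_mul_eq_mul_left two_pos ha
    exact hmod
  have hminus : HasModel (Matrix.toLin' γ.1) (stdAdj F n) (AlgGrp.sympAnti F (Fin D.aMinus))
      (e (Sum.inl (Sum.inr ()))) := by
    have hf : D.factor (Sum.inl (Sum.inr ())) = if ringChar F = 2 then 1 else X + 1 := rfl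
    have hf0 : (D.factor (Sum.inl (Sum.inr ()))).coeff 0 ≠ 0 := by
      rw [hf]
      split_ifs <;> simp
    have hfr' : (D.factor (Sum.inl (Sum.inr ()))).reciprocalPoly =
        D.factor (Sum.inl (Sum.inr ())) := by
      rw [hf]
      split_ifs
      · exact SymplecticFactorization.one_reciprocalPoly
      · exact SymplecticFactorization.X_add_one_reciprocalPoly
    obtain ⟨a, ha, hmod⟩ := hasModel_sympAnti hB (he _).idem (he _).comm
      (hadj (Sum.inl (Sum.inr ())) _ hf0 hfr') (c := -1)
      (fun v => by
        have := LinearMap.congr_fun (he (Sum.inl (Sum.inr ()))).kill v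
        rw [hf] at this
        -- In characteristic two the factor is 1 and e = 0, so the eigenvalue condition is vacuous
        -- and the block is the trivial Sp of rank 0.
        split_ifs at this with h
        · rw [map_one, one_mul] at this
          rw [this]
          simp
        · rw [map_add, aeval_X, map_one, add_mul, one_mul, LinearMap.add_apply] at this
          rw [neg_one_smul]
          exact eq_neg_of_add_eq_zero_left this)
    rw [hfr, hf] at ha
    have ha' : 2 * D.aMinus = 2 * a := by
      rw [← ha]
      change _ = 2 * D.aMinus * _
      split_ifs with h
      · rw [D.aMinus_eq_zero h, mul_zero, zero_mul]
      · have hdeg : (X + 1 : F[X]).natDegree = 1 := by simpa using natDegree_X_add_C (1 : F)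
        rw [hdeg, mul_one]
    obtain rfl : D.aMinus = a := Nat.eq_of_mul_eq_mul_left two_pos ha'
    exact hmod
  have hP : ∀ i, HasModel (Matrix.toLin' γ.1) (stdAdj F n) (AlgGrp.conjAnti F (σ i) (D.b i))
      (e (Sum.inr (Sum.inl i))) := fun i =>
    hasModel_conjAnti hB (he (Sum.inr (Sum.inl i)))
      (hadj (Sum.inr (Sum.inl i)) _
        (coeff_zero_ne_of_reciprocalPoly_eq (D.P_monic i) (D.P_reciprocal i)) (D.P_reciprocal i))
      rfl (stdAdj_mul_self γ).1 (D.P_monic i) (D.P_irreducible i) (D.P_reciprocal i)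
      (D.P_ne i).1 (D.P_ne i).2 (hfr _) (hL i) (hKL i) (σ i) (hσ i)
  have hQadj : ∀ j, stdAdj F n (e (Sum.inr (Sum.inr (Sum.inl j)))) =
      e (Sum.inr (Sum.inr (Sum.inr j))) := fun j => hadj _ _ (D.Q_coeff_zero j) rfl
  have hQ : ∀ j, HasModel (Matrix.toLin' γ.1) (stdAdj F n) (AlgGrp.swapAnti F (M j) (D.c j))
      (e (Sum.inr (Sum.inr (Sum.inl j))) + e (Sum.inr (Sum.inr (Sum.inr j)))) := fun j => by
    rw [← hQadj]
    refine hasModel_swapAnti hB (he (Sum.inr (Sum.inr (Sum.inl j))))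
      (fun g hg => commute_stdAdj γ hg) ?_ ?_ (D.Q_monic j) (D.Q_irreducible j) (hfr _) (hM j)
    · rw [hQadj]
      exact ho (by simp)
    · rw [hQadj]
      exact ho (by simp)
  have hPs := HasModel.pi hP fun i j hij => ho (by simpa using hij)
  have hQs := HasModel.pi hQ fun i j hij => by
    simp only [mul_add, add_mul]
    rw [ho (by simpa using hij), ho (by simp), ho (by simp), ho (by simpa using hij)]
    simp
  have hall := (((hplus.prod hminus (ho (by simp)) (ho (by simp))).prod hPs ?_ ?_).prod hQs ?_ ?_)
  · have h1 : e (Sum.inl (Sum.inl ())) + e (Sum.inl (Sum.inr ())) +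
        ∑ i, e (Sum.inr (Sum.inl i)) + ∑ j, (e (Sum.inr (Sum.inr (Sum.inl j))) +
          e (Sum.inr (Sum.inr (Sum.inr j)))) = 1 := by
      rw [← hsum, Finset.sum_add_distrib]
      simp only [Fintype.sum_sum_type, Finset.univ_unique, Finset.sum_singleton, add_assoc]
    rw [h1] at hall
    obtain ⟨i0⟩ := nonempty_iso_of_hasModel γ hall
    obtain ⟨i1⟩ := AlgGrp.iso_sympAnti (F := F) D.aPlus
    obtain ⟨i2⟩ := AlgGrp.iso_sympAnti (F := F) D.aMinus
    have trans : ∀ {G H I : AlgGrp.GroupFunctor F}, Nonempty (G ≅ H) → Nonempty (H ≅ I) →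
        Nonempty (G ≅ I) := fun ⟨a⟩ ⟨b⟩ => ⟨a.trans b⟩
    refine trans ⟨i0.symm⟩ (trans (AlgGrp.iso_prod _ _) (AlgGrp.prod_congr
      (trans (AlgGrp.iso_prod _ _) (AlgGrp.prod_congr
        (trans (AlgGrp.iso_prod _ _) (AlgGrp.prod_congr ⟨i1⟩ ⟨i2⟩)) ?_)) ?_))
    · exact trans (AlgGrp.iso_pi _) (AlgGrp.pi_congr fun i => AlgGrp.iso_conjAnti _ _)
    · exact trans (AlgGrp.iso_pi _) (AlgGrp.pi_congr fun j => AlgGrp.iso_swapAnti _)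
  · rw [add_mul, Finset.mul_sum, Finset.mul_sum, Finset.sum_eq_zero fun i _ => ho (by simp),
      Finset.sum_eq_zero fun i _ => ho (by simp), add_zero]
  · rw [mul_add, Finset.sum_mul, Finset.sum_mul, Finset.sum_eq_zero fun i _ => ho (by simp),
      Finset.sum_eq_zero fun i _ => ho (by simp), add_zero]
  · rw [Finset.mul_sum]
    refine Finset.sum_eq_zero fun j _ => ?_
    rw [add_mul, add_mul, mul_add, mul_add, Finset.sum_mul, Finset.sum_eq_zero fun i _ => ?_]
    · rw [ho (by simp), ho (by simp), ho (by simp), ho (by simp)]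
      simp
    · rw [mul_add, ho (by simp), ho (by simp), add_zero]
  · rw [Finset.sum_mul]
    refine Finset.sum_eq_zero fun j _ => ?_
    rw [mul_add, mul_add, add_mul, add_mul, Finset.mul_sum, Finset.sum_eq_zero fun i _ => ?_]
    · rw [ho (by simp), ho (by simp), ho (by simp), ho (by simp)]
      simp
    · rw [add_mul, ho (by simp), ho (by simp), add_zero]

end standard

theorem mainTheorem10 {F : Type u} [Field F] [Finite F] (n : ℕ)
    (γ : Matrix.symplecticGroup (Fin n) F)
    (hγ : Module.End.IsSemisimple
      (Matrix.toLin' (γ : Matrix (Fin n ⊕ Fin n) (Fin n ⊕ Fin n) F))) :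
    Nonempty (SymplecticFactorization
      (γ : Matrix (Fin n ⊕ Fin n) (Fin n ⊕ Fin n) F).charpoly) ∧
    ∀ D : SymplecticFactorization (γ : Matrix (Fin n ⊕ Fin n) (Fin n ⊕ Fin n) F).charpoly,
      ∃ (d : Fin D.r → ℕ) (e : Fin D.s → ℕ),
        (∀ i, 0 < d i ∧ (D.P i).natDegree = 2 * d i) ∧
        (∀ j, 0 < e j ∧ (D.Q j).natDegree = e j) ∧
        ∀ (K L : Fin D.r → Type u) (M : Fin D.s → Type u)
          [∀ i, Field (K i)] [∀ i, Algebra F (K i)]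
          [∀ i, Field (L i)] [∀ i, Algebra (K i) (L i)]
          [∀ j, Field (M j)] [∀ j, Algebra F (M j)]
          (σ : ∀ i, L i ≃ₐ[K i] L i),
          (∀ i, Module.finrank F (K i) = d i) →
          (∀ i, Module.finrank (K i) (L i) = 2) →
          (∀ i, σ i ≠ AlgEquiv.refl) →
          (∀ j, Module.finrank F (M j) = e j) →
          Nonempty (AlgGrp.spCentralizer γ ≅
            AlgGrp.prod (AlgGrp.prod (AlgGrp.prod
              (AlgGrp.Sp F D.aPlus) (AlgGrp.Sp F D.aMinus))
              (AlgGrp.pi fun i => AlgGrp.Res F (AlgGrp.U (σ i) (D.b i))))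
              (AlgGrp.pi fun j => AlgGrp.Res F (AlgGrp.GLn (M j) (D.c j)))) := by
  refine ⟨nonempty_symplecticFactorization (Matrix.charpoly_monic _)
    (reverse_charpoly_of_mem_symplecticGroup γ) (even_multiplicity γ hγ), fun D => ?_⟩
  choose d hd hd' using fun i => exists_natDegree_eq_two_mul (D.P_monic i) (D.P_irreducible i)
    (D.P_reciprocal i) (D.P_ne i).1 (D.P_ne i).2
  refine ⟨d, fun j => (D.Q j).natDegree, fun i => ⟨hd i, hd' i⟩,
    fun j => ⟨(D.Q_irreducible j).natDegree_pos, rfl⟩, ?_⟩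
  intro K L M _ _ _ _ _ _ σ hK hL hσ hM
  -- The F-algebra structure on L i is taken through K i, so that the tower formula gives degree 2 d
  -- i, the degree of P i.
  let _ : ∀ i, Algebra F (L i) := fun i =>
    ((algebraMap (K i) (L i)).comp (algebraMap F (K i))).toAlgebra
  have _ : ∀ i, IsScalarTower F (K i) (L i) := fun i => IsScalarTower.of_algebraMap_eq' rfl
  refine nonempty_iso_prod γ hγ D K L M σ (fun i => ?_) hL hσ hM
  rw [← Module.finrank_mul_finrank F (K i) (L i), hK, hL, hd', mul_comm]
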